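/- \textbf{Proposition (Littlewood--Paley).} There are absolute constants $0<c\le C<\infty$ such that for all real $C_0,C_1,L\ge 1$ there is $\varepsilon=\varepsilon(C_0,C_1,L)>0$ with the following property. Let $G$ be a compact group with Haar probability measure $|\cdot|$ and with a compatible bi-invariant metric $d$. Assume that $(G,d)$ is $L$-locally random with coefficient $C_0$, that is, $$\|\pi(x)-\pi(y)\|_{\mathrm{op}}\le C_0(\dim\pi)^L\,d(x,y)\qquad (x,y\in G)$$ for every irreducible unitary representation $\pi$ of $G$, and that $G$ satisfies the dimension condition with constants $C_1$ and $d_0>0$, that is, $$C_1^{-1}\eta^{d_0}\le |1_\eta|\le C_1\eta^{d_0}\qquad (0<\eta<1),$$ where $1_\eta$ is the open ball of radius $\eta$ centred at the identity. Let $a\ge 4Ld_0$, $0<\eta_0<\varepsilon$, and put $\eta_i=\eta_0^{a^i}$ for $i\ge 0$. Let $P_\eta=|1_\eta|^{-1}\mathbf 1_{1_\eta}$, let $(f*g)(x)=\int_G f(y)g(y^{-1}x)\,dy$, and define operators on $L^2(G)$ by $$\Delta_0(g)=P_{\eta_0}*g,\qquad \Delta_{i+1}(g)=(P_{\eta_{i+1}}-P_{\eta_i})*g\quad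 (i\ge 0).$$ Then for every $g\in L^2(G)$, $$c\,\|g\|_2^2\le\sum_{i=0}^\infty\|\Delta_i(g)\|_2^2\le C\,\|g\|_2^2 .$$ -/

import Mathlib

open MeasureTheory
open scoped ENNReal NNReal

universe u

noncomputable section

namespace LittlewoodPaley

/-- A homomorphism into the unitary group of a Hilbert space `H` is a (continuous) unitary
representation when the action map `G × H → H` is continuous. -/
def IsContinuousRep {G H : Type*} [Group G] [TopologicalSpace G]
    [NormedAddCommGroup H] [InnerProductSpace ℂ H] [CompleteSpace H]
    (π : G →* unitary (H →L[ℂ] H)) : Prop :=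
  Continuous fun p : G × H => (π p.1 : H →L[ℂ] H) p.2

/-- Irreducibility: `H` is nonzero and its only closed invariant subspaces are `0` and `H`. -/
def IsIrreducibleRep {G H : Type*} [Group G]
    [NormedAddCommGroup H] [InnerProductSpace ℂ H] [CompleteSpace H]
    (π : G →* unitary (H →L[ℂ] H)) : Prop :=
  Nontrivial H ∧ ∀ W : Submodule ℂ H, IsClosed (W : Set H) →
    (∀ x : G, ∀ v ∈ W, (π x : H →L[ℂ] H) v ∈ W) → W = ⊥ ∨ W = ⊤

/-- `(G, d)` is `L`-locally random with coefficient `C₀`: the metric of `G` is bi-invariant, and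
`‖π(x) - π(y)‖_op ≤ C₀ (dim π)^L d(x, y)` for every irreducible unitary representation `π` of `G`.
(Irreducible unitary representations of a compact group are finite-dimensional, so nothing is lost
in letting `π` range over the finite-dimensional ones, for which `dim π` is a number.) -/
structure IsLocallyRandom (G : Type u) [Group G] [MetricSpace G] (L C₀ : ℝ) : Prop where
  dist_mul_left : ∀ x y z : G, dist (z * x) (z * y) = dist x y
  dist_mul_right : ∀ x y z : G, dist (x * z) (y * z) = dist x y
  norm_sub_le : ∀ (H : Type u) [NormedAddCommGroup H] [InnerProductSpace ℂ H] [CompleteSpace H]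
    [FiniteDimensional ℂ H] (π : G →* unitary (H →L[ℂ] H)),
    IsContinuousRep π → IsIrreducibleRep π → ∀ x y : G,
      ‖(π x : H →L[ℂ] H) - (π y : H →L[ℂ] H)‖ ≤ C₀ * (Module.finrank ℂ H : ℝ) ^ L * dist x y

/-- The dimension condition `DC(C₁, d₀)`: `C₁⁻¹ η^{d₀} ≤ |1_η| ≤ C₁ η^{d₀}` for `0 < η < 1`, where
`1_η` is the open ball of radius `η` centred at the identity. -/
def DimensionCondition {G : Type*} [Group G] [MetricSpace G] [MeasurableSpace G]
    (μ : Measure G) (C₁ d₀ : ℝ) : Prop :=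
  ∀ η : ℝ, 0 < η → η < 1 →
    1 / C₁ * η ^ d₀ ≤ μ.real (Metric.ball (1 : G) η) ∧
      μ.real (Metric.ball (1 : G) η) ≤ C₁ * η ^ d₀

/-- Convolution of functions, `(f * g)(x) = ∫ f(y) g(y⁻¹ x) dy`. -/
def conv {G : Type*} [Group G] [MeasurableSpace G] (μ : Measure G) (f g : G → ℂ) : G → ℂ :=
  fun x => ∫ y, f y * g (y⁻¹ * x) ∂μ

/-- `P_η`, the `L¹`-normalized indicator function of the ball `1_η`. -/
def ballAvg {G : Type*} [Group G] [MetricSpace G] [MeasurableSpace G]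
    (μ : Measure G) (η : ℝ) : G → ℂ :=
  (Metric.ball (1 : G) η).indicator fun _ => ((μ.real (Metric.ball (1 : G) η))⁻¹ : ℂ)

/-- The scales `η_i = η₀^{a^i}`. -/
def scale (η₀ a : ℝ) (i : ℕ) : ℝ := η₀ ^ (a ^ i)

/-- The Littlewood–Paley operators: `Δ_0 g = P_{η_0} * g` and, for `i ≥ 0`,
`Δ_{i+1} g = (P_{η_{i+1}} - P_{η_i}) * g`. -/
def Delta {G : Type*} [Group G] [MetricSpace G] [MeasurableSpace G]
    (μ : Measure G) (η₀ a : ℝ) : ℕ → (G → ℂ) → (G → ℂ)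
  | 0, g => conv μ (ballAvg μ (scale η₀ a 0)) g
  | i + 1, g => conv μ (ballAvg μ (scale η₀ a (i + 1)) - ballAvg μ (scale η₀ a i)) g

end LittlewoodPaley

end

open LittlewoodPaley

/-! Convolution with `P_r` is the average of the left regular representation over the ball of radius
r. By bi-invariance balls are symmetric and conjugation-invariant, so these averages are
self-adjoint and commute with the representation; by Arzelà–Ascoli they are compact. Hence L²(G) is
the Hilbert sum of their joint eigenspaces, taken over the systems of eigenvalues l that occur on
irreducible subspaces (`topologicalClosure_iSup_jointEigenspace_ballOp`). Parseval
(`exists_spectral_weights`) then reduces the theorem to bounding, for each such l, the scalar sum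
l(η_0)² + Σ (l(η_{i+1}) - l(η_i))².

Let D be the dimension of an irreducible subspace with eigenvalues l. Local randomness gives |1 -
l(r)| ≤ C₀ D^L r, and the Hilbert–Schmidt norm gives D l(r)² ≤ 1/|1_r|
(`IsLocallyRandom.exists_dim`). Put q = η_i^{d₀}. If D q² ≥ 1, the second bound makes l(η_i) small.
Otherwise a ≥ 4Ld₀ gives η_{i+1} ≤ q^{4L}, and the first bound puts l(η_{i+1}) near 1. So l stays
near 0, crosses over within two steps and then stays near 1, with geometrically decaying errors; the
sum lies between absolute constants.

That decay, uniformly in d₀, rests on L d₀ ≥ 1 (`IsLocallyRandom.one_le_mul`), which also yields a ≥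
4. If L d₀ < 1, all dimensions D would be bounded, and one fixed ball average would be bounded below
on L²(G), which fails on normalized indicators of shrinking balls. -/

set_option linter.unusedSectionVars false

noncomputable section

namespace LittlewoodPaley

/-! ### Unitary representations: basic identities -/

section Representations

variable {G : Type*} [Group G]
  {H : Type*} [NormedAddCommGroup H] [InnerProductSpace ℂ H] [CompleteSpace H]

theorem rep_mul_apply (π : G →* unitary (H →L[ℂ] H)) (x y : G) (v : H) :
    (π (x * y) : H →L[ℂ] H) v = (π x : H →L[ℂ] H) ((π y : H →L[ℂ] H) v) := by
  simp [map_mul]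

theorem rep_one_apply (π : G →* unitary (H →L[ℂ] H)) (v : H) :
    (π 1 : H →L[ℂ] H) v = v := by
  simp

theorem rep_inv_apply_self (π : G →* unitary (H →L[ℂ] H)) (x : G) (v : H) :
    (π x⁻¹ : H →L[ℂ] H) ((π x : H →L[ℂ] H) v) = v := by
  rw [← rep_mul_apply, inv_mul_cancel, rep_one_apply]

theorem inner_rep_left (π : G →* unitary (H →L[ℂ] H)) (x : G) (v w : H) :
    inner ℂ ((π x : H →L[ℂ] H) v) w = inner ℂ v ((π x⁻¹ : H →L[ℂ] H) w) := by
  have h : (π x⁻¹ : H →L[ℂ] H) = star (π x : H →L[ℂ] H) := by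
    rw [map_inv]; rfl
  rw [h, ContinuousLinearMap.star_eq_adjoint, ContinuousLinearMap.adjoint_inner_right]

theorem IsContinuousRep.continuous_orbit [TopologicalSpace G] {π : G →* unitary (H →L[ℂ] H)}
    (hπ : IsContinuousRep π) (v : H) :
    Continuous fun y => (π y : H →L[ℂ] H) v :=
  hπ.comp (Continuous.prodMk_left v)

end Representations

/-! ### Averages of a representation over a subset of the group -/

section AveragingOperators

variable {G : Type*} [Group G] [MetricSpace G] [CompactSpace G]
  [MeasurableSpace G] [BorelSpace G] {μ : Measure G} [IsFiniteMeasure μ]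
  {H : Type*} [NormedAddCommGroup H] [InnerProductSpace ℂ H] [CompleteSpace H]
  {π : G →* unitary (H →L[ℂ] H)}

theorem IsContinuousRep.integrableOn_orbit (hπ : IsContinuousRep π) (v : H) (B : Set G) :
    IntegrableOn (fun y => (π y : H →L[ℂ] H) v) B μ :=
  ((hπ.continuous_orbit v).integrable_of_hasCompactSupport
    (HasCompactSupport.of_compactSpace _)).integrableOn

variable (μ) in
/-- The average over `B` of the operators of a continuous unitary representation. -/
def avgOp (hπ : IsContinuousRep π) (B : Set G) : H →L[ℂ] H :=
  LinearMap.mkContinuous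
    { toFun := fun v => ⨍ y in B, (π y : H →L[ℂ] H) v ∂μ
      map_add' := fun v w => by
        simp only [setAverage_eq, map_add]
        rw [integral_add (hπ.integrableOn_orbit v B) (hπ.integrableOn_orbit w B), smul_add]
      map_smul' := fun c v => by
        simp only [setAverage_eq, map_smul, RingHom.id_apply]
        rw [integral_smul, smul_comm] }
    1 fun v => by
      rw [one_mul]
      change ‖⨍ y in B, (π y : H →L[ℂ] H) v ∂μ‖ ≤ ‖v‖
      -- Over a null set the average is 0 by convention; otherwise it lies in every closed convex
      -- set containing the orbit.
      by_cases hB : μ B = 0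
      · rw [setAverage_eq, Measure.restrict_eq_zero.2 hB]; simp
      have := (convex_closedBall (0 : H) ‖v‖).set_average_mem Metric.isClosed_closedBall hB
        (measure_ne_top μ B) (f := fun y => (π y : H →L[ℂ] H) v)
        (Filter.Eventually.of_forall fun y => by simp [Unitary.norm_map])
        (hπ.integrableOn_orbit v B)
      simpa using this

theorem avgOp_apply (hπ : IsContinuousRep π) (B : Set G) (v : H) :
    avgOp μ hπ B v = ⨍ y in B, (π y : H →L[ℂ] H) v ∂μ := rfl

theorem norm_avgOp_apply_le (hπ : IsContinuousRep π) (B : Set G) (v : H) :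
    ‖avgOp μ hπ B v‖ ≤ ‖v‖ := by
  simpa using (avgOp μ hπ B).le_of_opNorm_le
    (LinearMap.mkContinuous_norm_le _ zero_le_one _) v

theorem avgOp_mem (hπ : IsContinuousRep π) (B : Set G) {W : Submodule ℂ H}
    (hWc : IsClosed (W : Set H)) (hW : ∀ x : G, ∀ v ∈ W, (π x : H →L[ℂ] H) v ∈ W)
    {v : H} (hv : v ∈ W) : avgOp μ hπ B v ∈ W := by
  by_cases hB : μ B = 0
  · rw [avgOp_apply, setAverage_eq, Measure.restrict_eq_zero.2 hB]; simp
  exact (W.restrictScalars ℝ).convex.set_average_mem hWc hB (measure_ne_top μ B)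
    (Filter.Eventually.of_forall fun y => hW y v hv) (hπ.integrableOn_orbit v B)

theorem norm_avgOp_apply_sub_le (hπ : IsContinuousRep π) {B : Set G} (hBm : MeasurableSet B)
    (hB : μ B ≠ 0) {v : H} {δ : ℝ} (h : ∀ y ∈ B, ‖(π y : H →L[ℂ] H) v - v‖ ≤ δ) :
    ‖avgOp μ hπ B v - v‖ ≤ δ := by
  have := (convex_closedBall v δ).set_average_mem Metric.isClosed_closedBall hB
    (measure_ne_top μ B) (f := fun y => (π y : H →L[ℂ] H) v)
    ((ae_restrict_iff' hBm).2 <| Filter.Eventually.of_forall fun y hy => by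
      simpa [dist_eq_norm] using h y hy)
    (hπ.integrableOn_orbit v B)
  rwa [mem_closedBall_iff_norm] at this

theorem inner_avgOp_right (hπ : IsContinuousRep π) (B : Set G) (v w : H) :
    inner ℂ v (avgOp μ hπ B w) = ⨍ y in B, inner ℂ v ((π y : H →L[ℂ] H) w) ∂μ := by
  rw [avgOp_apply, setAverage_eq, setAverage_eq, inner_smul_right_eq_smul,
    integral_inner (hπ.integrableOn_orbit w B)]

/-- The adjoint of π(y) is π(y⁻¹), and inversion preserves both B and the measure. -/
theorem avgOp_isSymmetric [IsTopologicalGroup G] [μ.IsInvInvariant] (hπ : IsContinuousRep π)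
    {B : Set G} (hB : B⁻¹ = B) :
    (avgOp μ hπ B : H →ₗ[ℂ] H).IsSymmetric := by
  intro v w
  have h1 : ∫ y in B, inner ℂ v ((π y : H →L[ℂ] H) w) ∂μ
      = ∫ y in B, inner ℂ v ((π y⁻¹ : H →L[ℂ] H) w) ∂μ := by
    have := (Measure.measurePreserving_inv μ).setIntegral_preimage_emb
      (Homeomorph.inv G).measurableEmbedding (fun y => inner ℂ v ((π y : H →L[ℂ] H) w)) B
    rw [← this, Set.inv_preimage, hB]
  simp only [ContinuousLinearMap.coe_coe]
  rw [inner_avgOp_right, ← inner_conj_symm, inner_avgOp_right, setAverage_eq, setAverage_eq, h1]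
  simp only [← inner_rep_left]
  simp only [Complex.real_smul, map_mul, Complex.conj_ofReal, ← integral_conj, inner_conj_symm]

/-- Since π(x)π(y) = π(xyx⁻¹)π(x), this is the change of variables y ↦ xyx⁻¹, which preserves B and
the measure. -/
theorem rep_avgOp_comm [IsTopologicalGroup G] [μ.IsMulLeftInvariant] [μ.IsMulRightInvariant]
    (hπ : IsContinuousRep π)
    {B : Set G} (hB : ∀ x y : G, x * y * x⁻¹ ∈ B ↔ y ∈ B) (x : G) (v : H) :
    (π x : H →L[ℂ] H) (avgOp μ hπ B v) = avgOp μ hπ B ((π x : H →L[ℂ] H) v) := by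
  have hmp : MeasurePreserving (fun y => x * y * x⁻¹) μ μ :=
    (measurePreserving_mul_right μ x⁻¹).comp (measurePreserving_mul_left μ x)
  have hemb : MeasurableEmbedding (fun y => x * y * x⁻¹) :=
    ((Homeomorph.mulLeft x).trans (Homeomorph.mulRight x⁻¹)).measurableEmbedding
  have h1 := hmp.setIntegral_preimage_emb hemb
    (fun y => (π y : H →L[ℂ] H) ((π x : H →L[ℂ] H) v)) B
  have h2 : (fun y => x * y * x⁻¹) ⁻¹' B = B := by ext y; exact hB x y
  rw [h2] at h1
  rw [avgOp_apply, avgOp_apply, setAverage_eq, setAverage_eq, ← h1,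
    ContinuousLinearMap.map_smul_of_tower,
    ← ContinuousLinearMap.integral_comp_comm _ (hπ.integrableOn_orbit v B)]
  congr 2
  ext y
  rw [← rep_mul_apply, ← rep_mul_apply, inv_mul_cancel_right]

/-- By continuity at 1, a small ball moves v by at most ‖v‖/2, hence so does the average. This
nondegeneracy makes the joint eigenspaces total. -/
theorem exists_ball_avgOp_apply_ne_zero [μ.IsOpenPosMeasure] (hπ : IsContinuousRep π)
    {v : H} (hv : v ≠ 0) :
    ∃ r > 0, avgOp μ hπ (Metric.ball (1 : G) r) v ≠ 0 := by
  have hv' : 0 < ‖v‖ / 2 := by have := norm_pos_iff.2 hv; positivity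
  obtain ⟨r, hr, h⟩ := Metric.continuousAt_iff.1 ((hπ.continuous_orbit v).continuousAt (x := (1 : G))) _ hv'
  refine ⟨r, hr, fun h0 => ?_⟩
  have := norm_avgOp_apply_sub_le hπ (μ := μ) (B := Metric.ball 1 r) Metric.isOpen_ball.measurableSet
    (Metric.measure_ball_pos μ _ hr).ne' (v := v) (δ := ‖v‖ / 2) fun y hy => by
      have := h (Metric.mem_ball.1 hy)
      rw [rep_one_apply, dist_eq_norm] at this
      exact this.le
  rw [h0, zero_sub, norm_neg] at this
  linarith

end AveragingOperators

/-! ### Irreducible subspaces and Schur's lemma for symmetric operators -/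

section IrreducibleSubspaces

variable {G : Type*} [Group G]
  {H : Type*} [NormedAddCommGroup H] [InnerProductSpace ℂ H] [CompleteSpace H]

/-- A nonzero finite-dimensional invariant subspace without proper nonzero invariant subspaces. -/
structure IsIrreducibleSubspace (π : G →* unitary (H →L[ℂ] H)) (W : Submodule ℂ H) : Prop where
  finiteDimensional : FiniteDimensional ℂ W
  ne_bot : W ≠ ⊥
  rep_mem : ∀ x : G, ∀ v ∈ W, (π x : H →L[ℂ] H) v ∈ W
  eq_bot_or_eq : ∀ U ≤ W, (∀ x : G, ∀ v ∈ U, (π x : H →L[ℂ] H) v ∈ U) → U = ⊥ ∨ U = W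

/-- A nonzero invariant subspace of minimal dimension is irreducible. -/
theorem exists_isIrreducibleSubspace_le {π : G →* unitary (H →L[ℂ] H)} {E : Submodule ℂ H}
    [FiniteDimensional ℂ E] (hE : E ≠ ⊥) (hinv : ∀ x : G, ∀ v ∈ E, (π x : H →L[ℂ] H) v ∈ E) :
    ∃ W ≤ E, IsIrreducibleSubspace π W := by
  let S : Set (Submodule ℂ H) :=
    {U | U ≤ E ∧ U ≠ ⊥ ∧ ∀ x : G, ∀ v ∈ U, (π x : H →L[ℂ] H) v ∈ U}
  obtain ⟨W, ⟨hWE, hW0, hW⟩, hmin⟩ := (measure fun U : Submodule ℂ H =>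
    Module.finrank ℂ U).wf.has_min S ⟨E, le_rfl, hE, hinv⟩
  have hfin : FiniteDimensional ℂ W := Submodule.finiteDimensional_of_le hWE
  refine ⟨W, hWE, hfin, hW0, hW, fun U hU hUinv => ?_⟩
  by_contra! h
  exact hmin U ⟨hU.trans hWE, h.1, hUinv⟩
    (Submodule.finrank_lt_finrank_of_lt (lt_of_le_of_ne hU h.2))

/-- A symmetric operator commuting with the representation is a real scalar on every irreducible
subspace it preserves. -/
theorem IsIrreducibleSubspace.exists_scalar {π : G →* unitary (H →L[ℂ] H)} {W : Submodule ℂ H}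
    (hW : IsIrreducibleSubspace π W) {T : H →L[ℂ] H} (hT : (T : H →ₗ[ℂ] H).IsSymmetric)
    (hTW : ∀ v ∈ W, T v ∈ W)
    (hcomm : ∀ x v, (π x : H →L[ℂ] H) (T v) = T ((π x : H →L[ℂ] H) v)) :
    ∃ c : ℝ, ∀ v ∈ W, T v = (c : ℂ) • v := by
  have := hW.finiteDimensional
  have : Nontrivial W := Submodule.nontrivial_iff_ne_bot.2 hW.ne_bot
  obtain ⟨c, hc⟩ := Module.End.exists_eigenvalue ((T : H →ₗ[ℂ] H).restrict hTW)
  have hcr : (starRingEnd ℂ) c = c := (hT.restrict_invariant hTW).conj_eigenvalue_eq_self hc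
  obtain ⟨w, hw, hw0⟩ := hc.exists_hasEigenvector
  rw [Module.End.mem_eigenspace_iff] at hw
  obtain h | h := hW.eq_bot_or_eq (W ⊓ Module.End.eigenspace (T : H →ₗ[ℂ] H) c) inf_le_left
    fun x v hv => ⟨hW.rep_mem x v hv.1, by
      have h2 := hv.2
      rw [SetLike.mem_coe, Module.End.mem_eigenspace_iff, ContinuousLinearMap.coe_coe] at h2 ⊢
      rw [← hcomm, h2, map_smul]⟩
  · refine absurd ?_ hw0
    have : (w : H) ∈ W ⊓ Module.End.eigenspace (T : H →ₗ[ℂ] H) c :=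
      ⟨w.2, Module.End.mem_eigenspace_iff.2 (congrArg Subtype.val hw)⟩
    rw [h, Submodule.mem_bot] at this
    exact Subtype.ext this
  · refine ⟨c.re, fun v hv => ?_⟩
    rw [← h] at hv
    rw [Complex.conj_eq_iff_re.1 hcr]
    exact Module.End.mem_eigenspace_iff.1 hv.2

/-- A nonzero closed invariant subspace on which some compact symmetric operator commuting with the
representation does not vanish contains an irreducible subspace. -/
theorem exists_isIrreducibleSubspace_le_of_isCompactOperator {π : G →* unitary (H →L[ℂ] H)}
    {Z : Submodule ℂ H} (hZc : IsClosed (Z : Set H))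
    (hZ : ∀ x : G, ∀ v ∈ Z, (π x : H →L[ℂ] H) v ∈ Z)
    {T : H →L[ℂ] H} (hT : (T : H →ₗ[ℂ] H).IsSymmetric) (hTc : IsCompactOperator T)
    (hTZ : ∀ v ∈ Z, T v ∈ Z)
    (hcomm : ∀ x v, (π x : H →L[ℂ] H) (T v) = T ((π x : H →L[ℂ] H) v))
    {z : H} (hz : z ∈ Z) (hTz : T z ≠ 0) : ∃ W ≤ Z, IsIrreducibleSubspace π W := by
  have : CompleteSpace Z := hZc.completeSpace_coe
  let S : Z →L[ℂ] Z := T.restrict hTZ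
  have hSc : IsCompactOperator S := hTc.restrict' (f := (T : H →ₗ[ℂ] H)) hTZ
  have hSs : (S : Z →ₗ[ℂ] Z).IsSymmetric := hT.restrict_invariant hTZ
  have hS0 : S ≠ 0 := fun h => hTz (by
    have : S ⟨z, hz⟩ = 0 := by rw [h]; rfl
    exact congrArg Subtype.val this)
  -- A nonzero compact symmetric operator has a nonzero eigenvalue; its eigenspace is
  -- finite-dimensional, and invariant because T commutes with π.
  have := mt (ContinuousLinearMap.eq_zero_of_forall_hasEigenvalue_eq_zero hSc hSs).1 hS0
  push Not at this
  obtain ⟨c, hc, hc0⟩ := this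
  have hfin := ContinuousLinearMap.finite_dimensional_eigenspace hSc c hc0
  have hfin' : FiniteDimensional ℂ
      ((Module.End.eigenspace (S : Z →ₗ[ℂ] Z) c).map Z.subtype) := inferInstance
  obtain ⟨W, hWE, hW⟩ := exists_isIrreducibleSubspace_le (π := π)
    (E := (Module.End.eigenspace (S : Z →ₗ[ℂ] Z) c).map Z.subtype)
    (by
      rw [Ne, (Submodule.map_injective_of_injective Z.subtype_injective).eq_iff' (Submodule.map_bot _)]
      exact hc)
    (by
      rintro x _ ⟨v, hv, rfl⟩
      refine ⟨⟨(π x : H →L[ℂ] H) v, hZ x v v.2⟩, ?_, rfl⟩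
      rw [SetLike.mem_coe, Module.End.mem_eigenspace_iff] at hv ⊢
      refine Subtype.ext ?_
      change T ((π x : H →L[ℂ] H) v) = c • (π x : H →L[ℂ] H) v
      rw [← hcomm, ← map_smul]
      exact congrArg (π x : H →L[ℂ] H) (congrArg Subtype.val hv))
  refine ⟨W, hWE.trans ?_, hW⟩
  rintro _ ⟨v, -, rfl⟩
  exact v.2

end IrreducibleSubspaces

/-! ### Restriction to finite-dimensional invariant subspaces -/

section Subrepresentations

variable {G : Type*} [Group G]
  {H : Type*} [NormedAddCommGroup H] [InnerProductSpace ℂ H] [CompleteSpace H]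

/-- The restriction of a unitary representation to a finite-dimensional invariant subspace. -/
def subrep (π : G →* unitary (H →L[ℂ] H)) (W : Submodule ℂ H) [FiniteDimensional ℂ W]
    (hW : ∀ x : G, ∀ v ∈ W, (π x : H →L[ℂ] H) v ∈ W) : G →* unitary (W →L[ℂ] W) :=
  (Unitary.linearIsometryEquiv (𝕜 := ℂ) (H := W)).symm.toMonoidHom.comp
    { toFun := fun x =>
        { toLinearEquiv := LinearEquiv.ofLinearMap
            ((π x : H →L[ℂ] H).toLinearMap.restrict (hW x))
            ((π x⁻¹ : H →L[ℂ] H).toLinearMap.restrict (hW x⁻¹))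
            (by
              ext v
              have := rep_inv_apply_self π x⁻¹ (v : H)
              rw [inv_inv] at this
              exact this)
            (by ext v; exact rep_inv_apply_self π x v)
          norm_map' := fun v => Unitary.norm_map (π x) (v : H) }
      map_one' := by ext v; exact rep_one_apply π v
      map_mul' := fun x y => by ext v; exact rep_mul_apply π x y v }

theorem IsContinuousRep.subrep [TopologicalSpace G] {π : G →* unitary (H →L[ℂ] H)}
    (hπ : IsContinuousRep π) (W : Submodule ℂ H) [FiniteDimensional ℂ W]
    (hW : ∀ x : G, ∀ v ∈ W, (π x : H →L[ℂ] H) v ∈ W) : IsContinuousRep (subrep π W hW) :=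
  (hπ.comp (continuous_fst.prodMk (continuous_subtype_val.comp continuous_snd))).subtype_mk
    fun p => hW p.1 p.2 p.2.2

theorem IsIrreducibleSubspace.isIrreducibleRep_subrep {π : G →* unitary (H →L[ℂ] H)}
    {W : Submodule ℂ H} (hW : IsIrreducibleSubspace π W) [FiniteDimensional ℂ W] :
    IsIrreducibleRep (subrep π W hW.rep_mem) := by
  refine ⟨Submodule.nontrivial_iff_ne_bot.2 hW.ne_bot, fun U _ hU => ?_⟩
  have hinj := Submodule.map_injective_of_injective W.subtype_injective
  obtain h | h := hW.eq_bot_or_eq (U.map W.subtype) (Submodule.map_subtype_le W U) (by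
    rintro x _ ⟨v, hv, rfl⟩
    exact ⟨_, hU x v hv, rfl⟩)
  · exact Or.inl ((hinj.eq_iff' (Submodule.map_bot _)).1 h)
  · exact Or.inr (hinj (by rw [h, Submodule.map_subtype_top]))

end Subrepresentations

/-- Local randomness applied to the subrepresentation on W at y and 1. `H` shares the universe of
`G` because that is where local randomness quantifies; L²(G) lies there. -/
theorem IsLocallyRandom.norm_rep_sub_le {G H : Type u} [Group G] [MetricSpace G]
    [NormedAddCommGroup H] [InnerProductSpace ℂ H] [CompleteSpace H]
    {L C₀ : ℝ} (hG : IsLocallyRandom G L C₀)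
    {π : G →* unitary (H →L[ℂ] H)} (hπ : IsContinuousRep π)
    {W : Submodule ℂ H} (hW : IsIrreducibleSubspace π W) (y : G) {v : H} (hv : v ∈ W) :
    ‖(π y : H →L[ℂ] H) v - v‖ ≤ C₀ * (Module.finrank ℂ W : ℝ) ^ L * dist y 1 * ‖v‖ := by
  have := hW.finiteDimensional
  have h := hG.norm_sub_le W (subrep π W hW.rep_mem) (hπ.subrep W hW.rep_mem)
    hW.isIrreducibleRep_subrep y 1
  have h2 := ContinuousLinearMap.le_of_opNorm_le _ h ⟨v, hv⟩
  have h3 : ((((subrep π W hW.rep_mem y : W →L[ℂ] W) - (subrep π W hW.rep_mem 1 : W →L[ℂ] W))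
      ⟨v, hv⟩ : W) : H) = (π y : H →L[ℂ] H) v - v := by
    rw [map_one]
    rfl
  rw [← h3]
  exact h2

/-! ### Orthogonality of joint eigenspaces and Parseval's identity -/

section Parseval

variable {H : Type*} [NormedAddCommGroup H] [InnerProductSpace ℂ H]

theorem _root_.OrthogonalFamily.hasSum_norm_sq {ι : Type*} {V : ι → Submodule ℂ H}
    (hV : OrthogonalFamily ℂ (fun i => V i) fun i => (V i).subtypeₗᵢ)
    {f : ∀ i, V i} {x : H} (hf : HasSum (fun i => (f i : H)) x) :
    HasSum (fun i => ‖f i‖ ^ 2) (‖x‖ ^ 2) := by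
  have h : Filter.Tendsto (fun s : Finset ι => ‖∑ i ∈ s, (f i : H)‖ ^ 2)
      Filter.atTop (nhds (‖x‖ ^ 2)) := (Filter.Tendsto.norm hf).pow 2
  refine h.congr fun s => ?_
  exact hV.norm_sum f s

/-- The joint eigenspace of a family of operators. -/
def jointEigenspace {ι : Type*} (T : ι → H →L[ℂ] H) (l : ι → ℝ) : Submodule ℂ H :=
  ⨅ i, Module.End.eigenspace (T i : H →ₗ[ℂ] H) (l i : ℂ)

theorem mem_jointEigenspace {ι : Type*} {T : ι → H →L[ℂ] H} {l : ι → ℝ} {v : H} :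
    v ∈ jointEigenspace T l ↔ ∀ i, T i v = (l i : ℂ) • v := by
  simp [jointEigenspace]

theorem isClosed_jointEigenspace {ι : Type*} (T : ι → H →L[ℂ] H) (l : ι → ℝ) :
    IsClosed (jointEigenspace T l : Set H) := by
  have : (jointEigenspace T l : Set H) = ⋂ i, {v | T i v = (l i : ℂ) • v} := by
    ext v; simp [mem_jointEigenspace]
  rw [this]
  exact isClosed_iInter fun i => isClosed_eq (T i).continuous (continuous_const_smul _)

theorem orthogonalFamily_jointEigenspace {ι : Type*} {T : ι → H →L[ℂ] H}
    (hT : ∀ i, (T i : H →ₗ[ℂ] H).IsSymmetric) (Λ : Set (ι → ℝ)) :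
    OrthogonalFamily ℂ (fun l : Λ => jointEigenspace T l)
      fun l => (jointEigenspace T (l : ι → ℝ)).subtypeₗᵢ := by
  intro l l' hne v w
  obtain ⟨i, hi⟩ := Function.ne_iff.1 (Subtype.coe_injective.ne hne)
  have h := hT i v w
  simp only [ContinuousLinearMap.coe_coe, mem_jointEigenspace.1 v.2 i,
    mem_jointEigenspace.1 w.2 i, inner_smul_left, inner_smul_right, Complex.conj_ofReal] at h
  by_contra h0
  exact hi (by exact_mod_cast mul_right_cancel₀ h0 h)

/-- Parseval's identity for all operators that are diagonal with respect to a total family of joint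
eigenspaces of symmetric operators. -/
theorem exists_spectral_weights [CompleteSpace H] {ι : Type*} {T : ι → H →L[ℂ] H}
    (hT : ∀ i, (T i : H →ₗ[ℂ] H).IsSymmetric) (Λ : Set (ι → ℝ))
    (hΛ : (⨆ l : Λ, jointEigenspace T l).topologicalClosure = ⊤) (g : H) :
    ∃ m : Λ → ℝ≥0∞, ∀ (S : H →L[ℂ] H) (s : Λ → ℝ),
      (∀ l : Λ, ∀ v ∈ jointEigenspace T l, S v = (s l : ℂ) • v) →
      ENNReal.ofReal (‖S g‖ ^ 2) = ∑' l, ENNReal.ofReal (s l ^ 2) * m l := by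
  have hc (l : Λ) : CompleteSpace (jointEigenspace T l) :=
    (isClosed_jointEigenspace T l).completeSpace_coe
  have hV := orthogonalFamily_jointEigenspace hT Λ
  have hs := IsHilbertSum.mkInternal _ hV hΛ.ge
  have hsum := hs.hasSum_linearIsometryEquiv_symm (hs.linearIsometryEquiv g)
  rw [LinearIsometryEquiv.symm_apply_apply] at hsum
  set f := hs.linearIsometryEquiv g
  -- The weights are the squared norms of the components of g. Values in `ℝ≥0∞` let sums be
  -- exchanged later without summability checks.
  refine ⟨fun l => ENNReal.ofReal (‖f l‖ ^ 2), fun S s hS => ?_⟩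
  have h1 : HasSum (fun l : Λ => (((s l : ℂ) • f l : jointEigenspace T (l : ι → ℝ)) : H)) (S g) := by
    convert hsum.mapL S using 1
    ext l
    exact (hS l _ (f l).2).symm
  have h2 := hV.hasSum_norm_sq h1
  rw [← h2.tsum_eq, ENNReal.ofReal_tsum_of_nonneg (fun _ => by positivity) h2.summable]
  refine tsum_congr fun l => ?_
  rw [← ENNReal.ofReal_mul (by positivity), norm_smul, mul_pow, Complex.norm_real, Real.norm_eq_abs,
    sq_abs]

end Parseval

/-! ### Totality of the joint eigenspaces -/

section JointEigenspaces

variable {G : Type*} [Group G]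
  {H : Type*} [NormedAddCommGroup H] [InnerProductSpace ℂ H] [CompleteSpace H]

theorem rep_mem_orthogonal {π : G →* unitary (H →L[ℂ] H)} {K : Submodule ℂ H}
    (hK : ∀ x : G, ∀ v ∈ K, (π x : H →L[ℂ] H) v ∈ K) (x : G) {v : H} (hv : v ∈ Kᗮ) :
    (π x : H →L[ℂ] H) v ∈ Kᗮ := by
  rw [Submodule.mem_orthogonal] at hv ⊢
  intro u hu
  have := hv _ (hK x⁻¹ u hu)
  rwa [inner_rep_left, inv_inv] at this

/-- The set of eigenvalue systems of a family of operators on irreducible subspaces. -/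
def irreducibleSpectrum {ι : Type*} (π : G →* unitary (H →L[ℂ] H)) (T : ι → H →L[ℂ] H) :
    Set (ι → ℝ) :=
  {l | ∃ W, IsIrreducibleSubspace π W ∧ W ≤ jointEigenspace T l}

/-- If the orthogonal complement of the span K were nonzero, some T i would not vanish on it, and
compactness would give an irreducible subspace there. By Schur it lies in a joint eigenspace counted
in K, a contradiction. -/
theorem topologicalClosure_iSup_jointEigenspace {ι : Type*} {π : G →* unitary (H →L[ℂ] H)}
    {T : ι → H →L[ℂ] H} (hT : ∀ i, (T i : H →ₗ[ℂ] H).IsSymmetric)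
    (hcomm : ∀ i x v, (π x : H →L[ℂ] H) (T i v) = T i ((π x : H →L[ℂ] H) v))
    (hTmem : ∀ i (W : Submodule ℂ H), IsClosed (W : Set H) →
      (∀ x : G, ∀ v ∈ W, (π x : H →L[ℂ] H) v ∈ W) → ∀ v ∈ W, T i v ∈ W)
    (hTc : ∀ i, IsCompactOperator (T i)) (hT0 : ∀ v ≠ 0, ∃ i, T i v ≠ 0) :
    (⨆ l : irreducibleSpectrum π T, jointEigenspace T l).topologicalClosure = ⊤ := by
  rw [Submodule.topologicalClosure_eq_top_iff]
  set K := ⨆ l : irreducibleSpectrum π T, jointEigenspace T l with hKdef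
  have hK : ∀ x : G, ∀ v ∈ K, (π x : H →L[ℂ] H) v ∈ K := by
    intro x v hv
    have : K ≤ K.comap (π x : H →L[ℂ] H).toLinearMap := by
      refine iSup_le fun l v hv => ?_
      refine Submodule.mem_iSup_of_mem (p := fun l : irreducibleSpectrum π T =>
        jointEigenspace T (l : ι → ℝ)) l ?_
      rw [mem_jointEigenspace] at hv ⊢
      intro i
      rw [ContinuousLinearMap.coe_coe, ← hcomm, hv i, map_smul]
    exact this hv
  by_contra hne
  obtain ⟨z, hz, hz0⟩ := Submodule.exists_mem_ne_zero_of_ne_bot hne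
  obtain ⟨i, hi⟩ := hT0 z hz0
  have hZ : ∀ x : G, ∀ v ∈ Kᗮ, (π x : H →L[ℂ] H) v ∈ Kᗮ :=
    fun x v hv => rep_mem_orthogonal hK x hv
  obtain ⟨W, hWK, hW⟩ := exists_isIrreducibleSubspace_le_of_isCompactOperator
    K.isClosed_orthogonal hZ (hT i) (hTc i)
    (hTmem i _ K.isClosed_orthogonal hZ) (hcomm i) hz hi
  have hfin := hW.finiteDimensional
  choose l hl using fun j => hW.exists_scalar (hT j)
    (hTmem j W W.closed_of_finiteDimensional hW.rep_mem) (hcomm j)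
  have hWl : W ≤ jointEigenspace T l := fun v hv => mem_jointEigenspace.2 fun j => hl j v hv
  have hWK' : W ≤ K := hWl.trans
    (le_iSup (fun l : irreducibleSpectrum π T => jointEigenspace T (l : ι → ℝ)) ⟨l, W, hW, hWl⟩)
  refine hW.ne_bot (le_bot_iff.1 ?_)
  rw [← K.inf_orthogonal_eq_bot]
  exact le_inf hWK' hWK

end JointEigenspaces

/-! ### Unimodularity of compact groups, from uniqueness of Haar probability measure -/

section Unimodular

variable {G : Type*} [Group G] [TopologicalSpace G] [IsTopologicalGroup G] [CompactSpace G]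
  [MeasurableSpace G] [BorelSpace G] (μ : Measure G) [μ.IsHaarMeasure] [IsProbabilityMeasure μ]

theorem isMulRightInvariant_of_compactSpace : μ.IsMulRightInvariant := by
  refine ⟨fun g => ?_⟩
  have := Measure.isProbabilityMeasure_map (μ := μ) (f := (· * g))
    (continuous_mul_const g).measurable.aemeasurable
  exact Measure.isHaarMeasure_eq_of_isProbabilityMeasure _ _

theorem isInvInvariant_of_compactSpace : μ.IsInvInvariant := by
  have := isMulRightInvariant_of_compactSpace μ
  refine ⟨?_⟩
  have h1 : μ.inv.IsMulLeftInvariant := inferInstance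
  have h2 : IsProbabilityMeasure μ.inv :=
    Measure.isProbabilityMeasure_map measurable_inv.aemeasurable
  have h3 : μ.inv.IsHaarMeasure :=
    { toIsFiniteMeasureOnCompacts := inferInstance
      toIsMulLeftInvariant := h1
      toIsOpenPosMeasure :=
        (Homeomorph.inv G).continuous.isOpenPosMeasure_map (Homeomorph.inv G).surjective }
  exact Measure.isHaarMeasure_eq_of_isProbabilityMeasure _ _

end Unimodular

/-! ### The left regular representation -/

section RegularRepresentation

variable {G : Type*} [Group G] [MetricSpace G] [IsTopologicalGroup G] [CompactSpace G]
  [MeasurableSpace G] [BorelSpace G] (μ : Measure G) [μ.IsHaarMeasure]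

/-- The left regular representation on `L²(G)`. -/
def regRep : G →* unitary (Lp ℂ 2 μ →L[ℂ] Lp ℂ 2 μ) :=
  (Unitary.linearIsometryEquiv (𝕜 := ℂ) (H := Lp ℂ 2 μ)).symm.toMonoidHom.comp
    { toFun := fun x =>
        -- `DomMulAct.mk` reverses products, so the inverse is what makes this a homomorphism in x.
        { toFun := fun f => DomMulAct.mk x⁻¹ • f
          invFun := fun f => DomMulAct.mk x • f
          left_inv := fun f => by
            change DomMulAct.mk x • DomMulAct.mk x⁻¹ • f = f
            rw [← mul_smul, ← DomMulAct.mk_mul, inv_mul_cancel, DomMulAct.mk_one, one_smul]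
          right_inv := fun f => by
            change DomMulAct.mk x⁻¹ • DomMulAct.mk x • f = f
            rw [← mul_smul, ← DomMulAct.mk_mul, mul_inv_cancel, DomMulAct.mk_one, one_smul]
          map_add' := fun f g => smul_add _ f g
          map_smul' := fun c f => smul_comm _ c f
          norm_map' := fun f => DomMulAct.norm_smul_Lp _ f }
      map_one' := by
        ext1 f
        change DomMulAct.mk (1 : G)⁻¹ • f = f
        rw [inv_one, DomMulAct.mk_one, one_smul]
      map_mul' := fun x y => by
        ext1 f
        change DomMulAct.mk (x * y)⁻¹ • f = DomMulAct.mk x⁻¹ • DomMulAct.mk y⁻¹ • f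
        rw [← mul_smul, ← DomMulAct.mk_mul, mul_inv_rev] }

theorem coeFn_regRep (x : G) (f : Lp ℂ 2 μ) :
    (regRep μ x : Lp ℂ 2 μ →L[ℂ] Lp ℂ 2 μ) f =ᵐ[μ] fun z => f (x⁻¹ * z) :=
  DomMulAct.smul_Lp_ae_eq (DomMulAct.mk x⁻¹) f

theorem isContinuousRep_regRep : IsContinuousRep (regRep μ) := by
  have : Fact ((2 : ℝ≥0∞) ≠ ∞) := ⟨ENNReal.ofNat_ne_top⟩
  change Continuous fun p : G × Lp ℂ 2 μ => DomMulAct.mk p.1⁻¹ • p.2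
  exact ((DomMulAct.continuous_mk).comp continuous_fst.inv).smul continuous_snd

end RegularRepresentation

/-! ### Balls of a bi-invariant metric -/

section Balls

variable {G : Type*} [Group G] [MetricSpace G]

theorem inv_ball_one (hl : ∀ x y z : G, dist (z * x) (z * y) = dist x y) (r : ℝ) :
    (Metric.ball (1 : G) r)⁻¹ = Metric.ball 1 r := by
  ext x
  rw [Set.mem_inv, Metric.mem_ball, Metric.mem_ball, ← hl _ _ x, mul_inv_cancel, mul_one, dist_comm]

theorem conj_mem_ball_one_iff (hl : ∀ x y z : G, dist (z * x) (z * y) = dist x y)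
    (hr : ∀ x y z : G, dist (x * z) (y * z) = dist x y) (r : ℝ) (x y : G) :
    x * y * x⁻¹ ∈ Metric.ball (1 : G) r ↔ y ∈ Metric.ball (1 : G) r := by
  rw [Metric.mem_ball, Metric.mem_ball, ← hr _ _ x, inv_mul_cancel_right, one_mul,
    ← hl y 1 x, mul_one]

theorem div_mem_ball_one_iff (hl : ∀ x y z : G, dist (z * x) (z * y) = dist x y)
    (hr : ∀ x y z : G, dist (x * z) (y * z) = dist x y) (r : ℝ) (x y : G) :
    x / y ∈ Metric.ball (1 : G) r ↔ x⁻¹ * y ∈ Metric.ball (1 : G) r := by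
  rw [Metric.mem_ball, Metric.mem_ball, ← hr _ _ y, ← hl (x⁻¹ * y) 1 x, div_mul_cancel, one_mul,
    mul_inv_cancel_left, mul_one, dist_comm]

end Balls

/-! ### Ball averages as compact convolution operators -/

section BallAverages

variable {G : Type*} [Group G] [MetricSpace G] [IsTopologicalGroup G] [CompactSpace G]
  [MeasurableSpace G] [BorelSpace G] (μ : Measure G) [μ.IsHaarMeasure]

theorem measure_ball_one_pos {r : ℝ} (hr : 0 < r) : 0 < μ.real (Metric.ball (1 : G) r) :=
  ENNReal.toReal_pos (Metric.measure_ball_pos μ _ hr).ne' (measure_ne_top μ _)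

theorem memLp_ballAvg (r : ℝ) (p : ℝ≥0∞) : MemLp (ballAvg μ r) p μ :=
  memLp_indicator_const p Metric.isOpen_ball.measurableSet _ (Or.inr (measure_ne_top μ _))

/-- The ball average `ballAvg μ r` as an element of `L²(G)`. -/
def ballVec (r : ℝ) : Lp ℂ 2 μ := (memLp_ballAvg μ r 2).toLp _

theorem norm_ballAvg (r : ℝ) (x : G) : ‖ballAvg μ r x‖ =
    (Metric.ball (1 : G) r).indicator (fun _ => (μ.real (Metric.ball (1 : G) r))⁻¹) x := by
  rw [ballAvg, norm_indicator_eq_indicator_norm, norm_inv, Complex.norm_real, Real.norm_eq_abs,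
    abs_of_nonneg measureReal_nonneg]

theorem norm_sq_Lp_two (f : Lp ℂ 2 μ) : ‖f‖ ^ 2 = ∫ x, ‖f x‖ ^ 2 ∂μ := by
  have h := L2.inner_def (𝕜 := ℂ) f f
  have h2 : (∫ x, inner ℂ (f x) (f x) ∂μ) = ((∫ x, ‖f x‖ ^ 2 ∂μ : ℝ) : ℂ) := by
    rw [← integral_complex_ofReal]
    refine integral_congr_ae (Filter.Eventually.of_forall fun x => ?_)
    simp [inner_self_eq_norm_sq_to_K]
  rw [h2, inner_self_eq_norm_sq_to_K] at h
  exact Complex.ofReal_injective ((Complex.ofReal_pow _ _).trans h)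

theorem norm_ballVec_sq {r : ℝ} (hr : 0 < r) :
    ‖ballVec μ r‖ ^ 2 = (μ.real (Metric.ball (1 : G) r))⁻¹ := by
  have h : ∫ x, ‖ballVec μ r x‖ ^ 2 ∂μ = ∫ x, (Metric.ball (1 : G) r).indicator
      (fun _ => (μ.real (Metric.ball (1 : G) r))⁻¹ ^ 2) x ∂μ := by
    refine integral_congr_ae ?_
    filter_upwards [(memLp_ballAvg μ r 2).coeFn_toLp] with x hx
    rw [ballVec, hx, norm_ballAvg]
    by_cases hxb : x ∈ Metric.ball (1 : G) r <;> simp [hxb]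
  rw [norm_sq_Lp_two, h, integral_indicator_const _ Metric.isOpen_ball.measurableSet, smul_eq_mul]
  have := (measure_ball_one_pos μ hr).ne'
  field_simp

variable [IsProbabilityMeasure μ]

theorem memLp_comp_div_left {g : G → ℂ} {p : ℝ≥0∞} (hg : MemLp g p μ) (x : G) :
    MemLp (fun y => g (y⁻¹ * x)) p μ := by
  have := isMulRightInvariant_of_compactSpace μ
  have := isInvInvariant_of_compactSpace μ
  exact hg.comp_measurePreserving
    ((measurePreserving_mul_right μ x).comp (Measure.measurePreserving_inv μ))

/-- Substituting y = xz⁻¹ pairs g with the translated ball indicator. Point values become inner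
products, so Cauchy–Schwarz and Bessel apply to them. -/
theorem conv_ballAvg_eq_inner (hl : ∀ x y z : G, dist (z * x) (z * y) = dist x y)
    (hr : ∀ x y z : G, dist (x * z) (y * z) = dist x y) (r : ℝ) {g : G → ℂ} (hg : MemLp g 2 μ)
    (x : G) : conv μ (ballAvg μ r) g x =
      inner ℂ ((regRep μ x : Lp ℂ 2 μ →L[ℂ] Lp ℂ 2 μ) (ballVec μ r)) (hg.toLp g) := by
  have := isInvInvariant_of_compactSpace μ
  rw [conv, ← integral_div_left_eq_self _ μ x, L2.inner_def]
  refine integral_congr_ae ?_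
  have h1 : ∀ᵐ z ∂μ, ballVec μ r (x⁻¹ * z) = ballAvg μ r (x⁻¹ * z) :=
    (measurePreserving_mul_left μ x⁻¹).quasiMeasurePreserving.ae
      (memLp_ballAvg μ r 2).coeFn_toLp
  filter_upwards [coeFn_regRep μ x (ballVec μ r), h1, hg.coeFn_toLp] with z hz1 hz2 hz3
  rw [hz1, hz2, hz3, RCLike.inner_apply, mul_comm]
  have h2 : (x / z)⁻¹ * x = z := by simp [div_eq_mul_inv, mul_assoc]
  have h3 : (starRingEnd ℂ) (ballAvg μ r (x⁻¹ * z)) = ballAvg μ r (x / z) := by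
    by_cases hm : x / z ∈ Metric.ball (1 : G) r
    · have hm' := (div_mem_ball_one_iff hl hr r x z).1 hm
      simp only [ballAvg, Set.indicator_of_mem hm, Set.indicator_of_mem hm', map_inv₀,
        Complex.conj_ofReal]
    · have hm' := mt (div_mem_ball_one_iff hl hr r x z).2 hm
      simp only [ballAvg, Set.indicator_of_notMem hm, Set.indicator_of_notMem hm', map_zero]
  rw [h2, h3, mul_comm]

/-- The operator on `L²(G)` averaging the regular representation over the ball of radius `r`. -/
def ballOp (r : ℝ) : Lp ℂ 2 μ →L[ℂ] Lp ℂ 2 μ :=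
  avgOp μ (isContinuousRep_regRep μ) (Metric.ball (1 : G) r)

/-- Convolution with `ballAvg μ r`, as an operator from `L²(G)` to bounded continuous functions. -/
def ballConv (r : ℝ) : Lp ℂ 2 μ →L[ℂ] BoundedContinuousFunction G ℂ :=
  LinearMap.mkContinuous
    { toFun := fun f => BoundedContinuousFunction.mkOfCompact
        ⟨fun x => inner ℂ ((regRep μ x : Lp ℂ 2 μ →L[ℂ] Lp ℂ 2 μ) (ballVec μ r)) f,
          ((isContinuousRep_regRep μ).continuous_orbit _).inner continuous_const⟩
      map_add' := fun f g => by ext x; exact inner_add_right (𝕜 := ℂ) (E := Lp ℂ 2 μ) _ _ _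
      map_smul' := fun c f => by ext x; exact inner_smul_right (𝕜 := ℂ) (E := Lp ℂ 2 μ) _ _ _ }
    ‖ballVec μ r‖ fun f => by
      refine (BoundedContinuousFunction.norm_le (by positivity)).2 fun x => ?_
      refine (norm_inner_le_norm (𝕜 := ℂ) (E := Lp ℂ 2 μ) _ _).trans ?_
      rw [Unitary.norm_map]

theorem ballConv_apply (r : ℝ) (f : Lp ℂ 2 μ) (x : G) : ballConv μ r f x =
    inner ℂ ((regRep μ x : Lp ℂ 2 μ →L[ℂ] Lp ℂ 2 μ) (ballVec μ r)) f := rfl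

/-- Arzelà–Ascoli: Cauchy–Schwarz bounds the image of the unit ball uniformly, and continuity of x ↦
π(x)`ballVec μ r` in L² makes it equicontinuous. -/
theorem isCompactOperator_ballConv (r : ℝ) : IsCompactOperator (ballConv μ r) := by
  refine (isCompactOperator_iff_isCompact_closure_image_closedBall
    (ballConv μ r : Lp ℂ 2 μ →ₗ[ℂ] BoundedContinuousFunction G ℂ) zero_lt_one).2 ?_
  refine BoundedContinuousFunction.arzela_ascoli
    (Metric.closedBall 0 ‖ballVec μ r‖) (isCompact_closedBall _ _) _ ?_ ?_
  · rintro _ x ⟨f, hf, rfl⟩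
    rw [mem_closedBall_zero_iff] at hf ⊢
    refine (norm_inner_le_norm (𝕜 := ℂ) (E := Lp ℂ 2 μ) _ _).trans ?_
    rw [Unitary.norm_map]
    exact mul_le_of_le_one_right (norm_nonneg _) hf
  · intro x₀
    refine Metric.equicontinuousAt_of_continuity_modulus
      (fun x => ‖(regRep μ x₀ : Lp ℂ 2 μ →L[ℂ] Lp ℂ 2 μ) (ballVec μ r) -
        (regRep μ x : Lp ℂ 2 μ →L[ℂ] Lp ℂ 2 μ) (ballVec μ r)‖) ?_ _ ?_
    · have h := ((continuous_const.sub
        ((isContinuousRep_regRep μ).continuous_orbit (ballVec μ r))).norm).tendsto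
        (f := fun x => ‖(regRep μ x₀ : Lp ℂ 2 μ →L[ℂ] Lp ℂ 2 μ) (ballVec μ r) -
        (regRep μ x : Lp ℂ 2 μ →L[ℂ] Lp ℂ 2 μ) (ballVec μ r)‖) x₀
      simpa using h
    · refine Filter.Eventually.of_forall ?_
      rintro x ⟨_, f, hf, rfl⟩
      rw [mem_closedBall_zero_iff] at hf
      change dist (ballConv μ r f x₀) (ballConv μ r f x) ≤ _
      rw [dist_eq_norm, ballConv_apply, ballConv_apply, ← inner_sub_left]
      exact (norm_inner_le_norm (𝕜 := ℂ) (E := Lp ℂ 2 μ) _ _).trans (mul_le_of_le_one_right (norm_nonneg _) hf)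

/-- Averaging the regular representation over a ball is convolution with `ballAvg μ r`. -/
theorem ballOp_eq_toLp (hl : ∀ x y z : G, dist (z * x) (z * y) = dist x y)
    (hr : ∀ x y z : G, dist (x * z) (y * z) = dist x y) (r : ℝ) (g : Lp ℂ 2 μ) :
    ballOp μ r g = BoundedContinuousFunction.toLp 2 μ ℂ (ballConv μ r g) := by
  refine ext_inner_left ℂ fun h => ?_
  have hB : MeasurableSet (Metric.ball (1 : G) r) := Metric.isOpen_ball.measurableSet
  have hconv : ∀ x, ballConv μ r g x = conv μ (ballAvg μ r) g x := fun x => by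
    rw [conv_ballAvg_eq_inner μ hl hr r (Lp.memLp g) x, Lp.toLp_coeFn, ballConv_apply]
  -- Fubini hypothesis: a bounded kernel times two L² functions on G × G, as (y, x) ↦ y⁻¹x is
  -- measure preserving.
  have hF : Integrable (Function.uncurry fun y x : G =>
      ballAvg μ r y * (g (y⁻¹ * x) * (starRingEnd ℂ) (h x))) (μ.prod μ) := by
    have h1 : MemLp (fun p : G × G => g (p.1⁻¹ * p.2)) 2 (μ.prod μ) :=
      (Lp.memLp g).comp_measurePreserving
        (measurePreserving_snd.comp (measurePreserving_prod_inv_mul μ μ))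
    have h2 : MemLp (fun p : G × G => (starRingEnd ℂ) (h p.2)) 2 (μ.prod μ) :=
      ((Lp.memLp h).comp_measurePreserving measurePreserving_snd).star
    refine (h1.integrable_mul h2).bdd_mul (c := (μ.real (Metric.ball (1 : G) r))⁻¹) ?_ ?_
    · exact ((memLp_ballAvg μ r 2).1.comp_measurePreserving measurePreserving_fst)
    · refine Filter.Eventually.of_forall fun p => ?_
      rw [norm_ballAvg]
      exact Set.indicator_le_self' (fun _ _ => inv_nonneg.2 measureReal_nonneg) _
  rw [ballOp, inner_avgOp_right, setAverage_eq, L2.inner_def]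
  calc (μ.real (Metric.ball (1 : G) r))⁻¹ • ∫ y in Metric.ball (1 : G) r,
        inner ℂ h ((regRep μ y : Lp ℂ 2 μ →L[ℂ] Lp ℂ 2 μ) g) ∂μ
      = ∫ y, ballAvg μ r y * inner ℂ h ((regRep μ y : Lp ℂ 2 μ →L[ℂ] Lp ℂ 2 μ) g) ∂μ := by
        rw [← integral_indicator hB, ← integral_smul]
        congr 1
        ext y
        by_cases hy : y ∈ Metric.ball (1 : G) r <;> simp [ballAvg, hy]
    _ = ∫ y, ∫ x, ballAvg μ r y * (g (y⁻¹ * x) * (starRingEnd ℂ) (h x)) ∂μ ∂μ := by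
        congr 1
        ext y
        rw [integral_const_mul, L2.inner_def]
        congr 1
        refine integral_congr_ae ?_
        filter_upwards [coeFn_regRep μ y g] with x hx
        rw [hx, RCLike.inner_apply]
    _ = ∫ x, ∫ y, ballAvg μ r y * (g (y⁻¹ * x) * (starRingEnd ℂ) (h x)) ∂μ ∂μ :=
        integral_integral_swap hF
    _ = ∫ x, inner ℂ (h x) (BoundedContinuousFunction.toLp 2 μ ℂ (ballConv μ r g) x) ∂μ := by
        refine integral_congr_ae ?_
        filter_upwards [BoundedContinuousFunction.coeFn_toLp (p := 2) (𝕜 := ℂ) μ (ballConv μ r g)]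
          with x hx
        rw [hx, hconv, RCLike.inner_apply, conv, ← integral_mul_const]
        simp only [mul_assoc]

end BallAverages

/-! ### Norm bounds and spectrum of the ball averages -/

section BallOperators

variable {G : Type*} [Group G] [MetricSpace G] [IsTopologicalGroup G] [CompactSpace G]
  [MeasurableSpace G] [BorelSpace G] (μ : Measure G) [μ.IsHaarMeasure] [IsProbabilityMeasure μ]

theorem norm_ballOp_sq (hl : ∀ x y z : G, dist (z * x) (z * y) = dist x y)
    (hr : ∀ x y z : G, dist (x * z) (y * z) = dist x y) (r : ℝ) (f : Lp ℂ 2 μ) :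
    ‖ballOp μ r f‖ ^ 2 = ∫ x, ‖ballConv μ r f x‖ ^ 2 ∂μ := by
  rw [ballOp_eq_toLp μ hl hr, norm_sq_Lp_two]
  refine integral_congr_ae ?_
  filter_upwards [BoundedContinuousFunction.coeFn_toLp (p := 2) (𝕜 := ℂ) μ (ballConv μ r f)]
    with x hx
  rw [hx]

theorem integrable_norm_ballConv_sq (r : ℝ) (f : Lp ℂ 2 μ) :
    Integrable (fun x => ‖ballConv μ r f x‖ ^ 2) μ :=
  ((ballConv μ r f).continuous.norm.pow 2).integrable_of_hasCompactSupport
    (HasCompactSupport.of_compactSpace _)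

/-- The Hilbert–Schmidt bound for convolution with a ball average. -/
theorem sum_norm_ballOp_sq_le (hl : ∀ x y z : G, dist (z * x) (z * y) = dist x y)
    (hr : ∀ x y z : G, dist (x * z) (y * z) = dist x y) {r : ℝ} (hr0 : 0 < r)
    {ι : Type*} [Fintype ι] {w : ι → Lp ℂ 2 μ} (hw : Orthonormal ℂ w) :
    ∑ i, ‖ballOp μ r (w i)‖ ^ 2 ≤ (μ.real (Metric.ball (1 : G) r))⁻¹ := by
  simp only [norm_ballOp_sq μ hl hr]
  rw [← integral_finsetSum _ fun i _ => integrable_norm_ballConv_sq μ r (w i),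
    ← norm_ballVec_sq μ hr0]
  -- Bessel's inequality at each point x, to be integrated over a probability space.
  have h : ∀ x, ∑ i, ‖ballConv μ r (w i) x‖ ^ 2 ≤ ‖ballVec μ r‖ ^ 2 := fun x => by
    have := hw.sum_inner_products_le (s := Finset.univ)
      ((regRep μ x : Lp ℂ 2 μ →L[ℂ] Lp ℂ 2 μ) (ballVec μ r))
    rw [Unitary.norm_map] at this
    simpa only [ballConv_apply, norm_inner_symm] using this
  refine (integral_mono (integrable_finsetSum _ fun i _ => integrable_norm_ballConv_sq μ r (w i))
    (integrable_const _) h).trans ?_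
  simp

theorem finrank_mul_sq_le (hl : ∀ x y z : G, dist (z * x) (z * y) = dist x y)
    (hr : ∀ x y z : G, dist (x * z) (y * z) = dist x y) {r : ℝ} (hr0 : 0 < r)
    {W : Submodule ℂ (Lp ℂ 2 μ)} [FiniteDimensional ℂ W] {c : ℝ}
    (hc : ∀ v ∈ W, ballOp μ r v = (c : ℂ) • v) :
    Module.finrank ℂ W * c ^ 2 ≤ (μ.real (Metric.ball (1 : G) r))⁻¹ := by
  have hb := (stdOrthonormalBasis ℂ W).orthonormal.comp_linearIsometry W.subtypeₗᵢ
  refine le_trans (le_of_eq ?_) (sum_norm_ballOp_sq_le μ hl hr hr0 hb)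
  have h : ∀ i, ‖ballOp μ r ((W.subtypeₗᵢ ∘ stdOrthonormalBasis ℂ W) i)‖ ^ 2 = c ^ 2 := fun i => by
    rw [hc ((W.subtypeₗᵢ ∘ stdOrthonormalBasis ℂ W) i) (stdOrthonormalBasis ℂ W i).2, norm_smul, hb.1 i, mul_one, Complex.norm_real,
      Real.norm_eq_abs, sq_abs]
  simp only [h, Finset.sum_const, Finset.card_univ, Fintype.card_fin, nsmul_eq_mul]

/-- Young's bound ‖P_r * P_s‖_∞ ≤ ‖P_r‖_∞ ‖P_s‖_1 with ‖P_s‖_1 = 1. The point is that the bound does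
not depend on s, while ‖P_s‖_2 may blow up. -/
theorem norm_ballOp_ballVec_le (hl : ∀ x y z : G, dist (z * x) (z * y) = dist x y)
    (hr : ∀ x y z : G, dist (x * z) (y * z) = dist x y) (r : ℝ) {s : ℝ} (hs : 0 < s) :
    ‖ballOp μ r (ballVec μ s)‖ ≤ (μ.real (Metric.ball (1 : G) r))⁻¹ := by
  have := isMulRightInvariant_of_compactSpace μ
  have := isInvInvariant_of_compactSpace μ
  have h0 : 0 ≤ (μ.real (Metric.ball (1 : G) r))⁻¹ := inv_nonneg.2 measureReal_nonneg
  have hint : ∫ y, ‖ballAvg μ s y‖ ∂μ = 1 := by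
    simp only [norm_ballAvg]
    rw [integral_indicator_const _ Metric.isOpen_ball.measurableSet, smul_eq_mul,
      mul_inv_cancel₀ (measure_ball_one_pos μ hs).ne']
  have h : ∀ x, ‖ballConv μ r (ballVec μ s) x‖ ≤ (μ.real (Metric.ball (1 : G) r))⁻¹ := fun x => by
    rw [ballConv_apply, ballVec, ballVec, ← ballVec,
      ← conv_ballAvg_eq_inner μ hl hr r (memLp_ballAvg μ s 2) x, conv]
    have hi : Integrable (fun y => ‖ballAvg μ s (y⁻¹ * x)‖) μ :=
      (memLp_one_iff_integrable.1 (memLp_comp_div_left μ (memLp_ballAvg μ s 1) x)).norm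
    refine (norm_integral_le_of_norm_le (hi.const_mul (μ.real (Metric.ball (1 : G) r))⁻¹)
      (Filter.Eventually.of_forall fun y => ?_)).trans (le_of_eq ?_)
    · rw [norm_mul, norm_ballAvg μ r]
      exact mul_le_mul_of_nonneg_right (Set.indicator_le_self' (fun _ _ => h0) _) (norm_nonneg _)
    · rw [integral_const_mul]
      have : ∫ y, ‖ballAvg μ s (y⁻¹ * x)‖ ∂μ = ∫ y, ‖ballAvg μ s y‖ ∂μ := by
        rw [← integral_mul_right_eq_self (fun y => ‖ballAvg μ s y‖) x,
          ← integral_inv_eq_self (fun y => ‖ballAvg μ s (y * x)‖)]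
      rw [this, hint, mul_one]
  refine le_of_sq_le_sq ?_ h0
  rw [norm_ballOp_sq μ hl hr]
  refine (integral_mono (integrable_norm_ballConv_sq μ r _) (integrable_const _) fun x =>
    pow_le_pow_left₀ (norm_nonneg _) (h x) 2).trans ?_
  simp

theorem ballOp_isSymmetric (hl : ∀ x y z : G, dist (z * x) (z * y) = dist x y) (r : ℝ) :
    (ballOp μ r : Lp ℂ 2 μ →ₗ[ℂ] Lp ℂ 2 μ).IsSymmetric := by
  have := isInvInvariant_of_compactSpace μ
  exact avgOp_isSymmetric _ (inv_ball_one hl r)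

theorem topologicalClosure_iSup_jointEigenspace_ballOp
    (hl : ∀ x y z : G, dist (z * x) (z * y) = dist x y)
    (hr : ∀ x y z : G, dist (x * z) (y * z) = dist x y) :
    (⨆ l : irreducibleSpectrum (regRep μ) (ballOp μ),
      jointEigenspace (ballOp μ) l).topologicalClosure = ⊤ := by
  have := isMulRightInvariant_of_compactSpace μ
  refine topologicalClosure_iSup_jointEigenspace (ballOp_isSymmetric μ hl) ?_ ?_ ?_ ?_
  · exact fun r x v => rep_avgOp_comm _ (conj_mem_ball_one_iff hl hr r) x v
  · exact fun r W hWc hW v hv => avgOp_mem _ _ hWc hW hv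
  · intro r
    have : (ballOp μ r : Lp ℂ 2 μ → Lp ℂ 2 μ) =
        BoundedContinuousFunction.toLp 2 μ ℂ ∘ ballConv μ r :=
      funext fun g => ballOp_eq_toLp μ hl hr r g
    rw [this]
    exact (isCompactOperator_ballConv μ r).clm_comp _
  · intro v hv
    obtain ⟨r, -, h⟩ := exists_ball_avgOp_apply_ne_zero (μ := μ) (isContinuousRep_regRep μ) hv
    exact ⟨r, h⟩

theorem abs_le_one_of_mem_irreducibleSpectrum {l : ℝ → ℝ}
    (h : l ∈ irreducibleSpectrum (regRep μ) (ballOp μ)) (r : ℝ) : |l r| ≤ 1 := by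
  obtain ⟨W, hW, hWl⟩ := h
  obtain ⟨v, hv, hv0⟩ := Submodule.exists_mem_ne_zero_of_ne_bot hW.ne_bot
  have h1 := norm_avgOp_apply_le (μ := μ) (isContinuousRep_regRep μ) (Metric.ball (1 : G) r) v
  change ‖ballOp μ r v‖ ≤ _ at h1
  rw [mem_jointEigenspace.1 (hWl hv) r, norm_smul, Complex.norm_real, Real.norm_eq_abs] at h1
  exact (mul_le_iff_le_one_left (norm_pos_iff.2 hv0)).1 h1

end BallOperators

/-! ### Eigenvalues against dimension, and the inequality L d₀ ≥ 1 -/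

section LocallyRandom

variable {G : Type u} [Group G] [MetricSpace G] [IsTopologicalGroup G] [CompactSpace G]
  [MeasurableSpace G] [BorelSpace G] (μ : Measure G) [μ.IsHaarMeasure] [IsProbabilityMeasure μ]
  {L C₀ C₁ d₀ : ℝ}

/-- Every irreducible system of eigenvalues of ball averages has a dimension that controls it. -/
theorem IsLocallyRandom.exists_dim (hG : IsLocallyRandom G L C₀) (hC₀ : 0 ≤ C₀) {l : ℝ → ℝ}
    (h : l ∈ irreducibleSpectrum (regRep μ) (ballOp μ)) :
    ∃ D : ℝ, 1 ≤ D ∧ ∀ r, 0 < r → |1 - l r| ≤ C₀ * D ^ L * r ∧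
      D * l r ^ 2 ≤ (μ.real (Metric.ball (1 : G) r))⁻¹ := by
  obtain ⟨W, hW, hWl⟩ := h
  have hfin := hW.finiteDimensional
  have hnt : Nontrivial W := Submodule.nontrivial_iff_ne_bot.2 hW.ne_bot
  obtain ⟨v, hv, hv0⟩ := Submodule.exists_mem_ne_zero_of_ne_bot hW.ne_bot
  refine ⟨Module.finrank ℂ W, by exact_mod_cast Module.finrank_pos (R := ℂ) (M := W),
    fun r hr => ⟨?_, ?_⟩⟩
  · have h1 := norm_avgOp_apply_sub_le (μ := μ) (isContinuousRep_regRep μ)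
      (B := Metric.ball (1 : G) r) Metric.isOpen_ball.measurableSet
      (Metric.measure_ball_pos μ _ hr).ne' (v := v)
      (δ := C₀ * (Module.finrank ℂ W : ℝ) ^ L * r * ‖v‖) fun y hy => by
        refine (hG.norm_rep_sub_le (isContinuousRep_regRep μ) hW y hv).trans ?_
        have := (Metric.mem_ball.1 hy).le
        gcongr
    change ‖ballOp μ r v - v‖ ≤ _ at h1
    have h2 : ballOp μ r v - v = ((l r - 1 : ℝ) : ℂ) • v := by
      rw [mem_jointEigenspace.1 (hWl hv) r]; push_cast; rw [sub_smul, one_smul]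
    rw [h2, norm_smul, Complex.norm_real, Real.norm_eq_abs, abs_sub_comm] at h1
    exact le_of_mul_le_mul_right h1 (norm_pos_iff.2 hv0)
  · exact finrank_mul_sq_le μ hG.dist_mul_left hG.dist_mul_right hr
      fun v hv => mem_jointEigenspace.1 (hWl hv) r

theorem DimensionCondition.inv_measure_ball_le (hD : DimensionCondition μ C₁ d₀) (hC₁ : 1 ≤ C₁)
    {r : ℝ} (hr : 0 < r) (hr1 : r < 1) :
    (μ.real (Metric.ball (1 : G) r))⁻¹ ≤ C₁ * r ^ (-d₀) := by
  have h := (hD r hr hr1).1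
  have hp : 0 < r ^ d₀ := Real.rpow_pos_of_pos hr _
  rw [Real.rpow_neg hr.le]
  have := inv_anti₀ (by positivity) h
  rwa [one_div, mul_inv, inv_inv] at this

/-- A locally random group satisfying the dimension condition has irreducible representations of
unbounded dimension, which forces `L * d₀ ≥ 1`. -/
theorem IsLocallyRandom.one_le_mul (hG : IsLocallyRandom G L C₀) (hD : DimensionCondition μ C₁ d₀)
    (hC₀ : 1 ≤ C₀) (hC₁ : 1 ≤ C₁) (hL : 1 ≤ L) (hd₀ : 0 < d₀) : 1 ≤ L * d₀ := by
  by_contra! hlt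
  have hC₀' : 0 < C₀ := by linarith
  have hC₁' : 0 < C₁ := by linarith
  have hbase : 1 ≤ 4 * C₁ * (2 * C₀) ^ d₀ := by
    have := Real.one_le_rpow (by linarith : 1 ≤ 2 * C₀) hd₀.le
    nlinarith
  -- At r = (2 C₀ D^L)⁻¹ the eigenvalue is at least 1/2, so D/4 ≤ C₁ r^{-d₀}, that is D^{1 - L d₀} ≤
  -- K. As L d₀ < 1, this bounds every D by M.
  set K : ℝ := 4 * C₁ * (2 * C₀) ^ d₀ with hK
  set M : ℝ := K ^ (1 - L * d₀)⁻¹ with hM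
  have hM1 : 1 ≤ M := Real.one_le_rpow hbase (inv_nonneg.2 (by linarith))
  have hrad : ∀ D : ℝ, 1 ≤ D → 0 < (2 * C₀ * D ^ L)⁻¹ ∧ (2 * C₀ * D ^ L)⁻¹ < 1 := fun D hD1 => by
    have := Real.one_le_rpow hD1 (by linarith : 0 ≤ L)
    exact ⟨by positivity, inv_lt_one_of_one_lt₀ (by nlinarith)⟩
  set r₀ : ℝ := (2 * C₀ * M ^ L)⁻¹ with hr₀
  have hspec : ∀ l ∈ irreducibleSpectrum (regRep μ) (ballOp μ), 1 / 4 ≤ l r₀ ^ 2 := by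
    intro l hl
    obtain ⟨D, hD1, hlD⟩ := hG.exists_dim μ hC₀'.le hl
    have hDL : 0 < D ^ L := Real.rpow_pos_of_pos (by linarith) _
    have hML : 0 < M ^ L := Real.rpow_pos_of_pos (by linarith) _
    have hDM : D ≤ M := by
      obtain ⟨hr0, hr1⟩ := hrad D hD1
      obtain ⟨h1, h2⟩ := hlD _ hr0
      have h3 : C₀ * D ^ L * (2 * C₀ * D ^ L)⁻¹ = 1 / 2 := by field_simp
      rw [h3, abs_le] at h1
      have h4 := h2.trans (hD.inv_measure_ball_le μ hC₁ hr0 hr1)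
      have h5 : (2 * C₀ * D ^ L)⁻¹ ^ (-d₀) = (2 * C₀) ^ d₀ * D ^ (L * d₀) := by
        rw [Real.rpow_neg (by positivity), Real.inv_rpow (by positivity), inv_inv,
          Real.mul_rpow (by positivity) hDL.le, Real.rpow_mul (by linarith)]
      rw [h5] at h4
      have h6 : D ≤ K * D ^ (L * d₀) := by
        have : (1 / 4 : ℝ) ≤ l (2 * C₀ * D ^ L)⁻¹ ^ 2 := by nlinarith [h1.2]
        rw [hK]
        linarith [mul_le_mul_of_nonneg_left this (by linarith : 0 ≤ D)]
      have h7 : D ^ (1 - L * d₀) ≤ K := by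
        rw [Real.rpow_sub (by linarith), Real.rpow_one, div_le_iff₀ (by positivity)]
        exact h6
      calc D = (D ^ (1 - L * d₀)) ^ (1 - L * d₀)⁻¹ := by
            rw [← Real.rpow_mul (by linarith), mul_inv_cancel₀ (by linarith), Real.rpow_one]
        _ ≤ M := Real.rpow_le_rpow (by positivity) h7 (inv_nonneg.2 (by linarith))
    have h1 := (hlD _ (hrad M hM1).1).1
    have h2 : C₀ * D ^ L * r₀ ≤ C₀ * M ^ L * r₀ := by
      have := (hrad M hM1).1
      have := Real.rpow_le_rpow (by linarith) hDM (by linarith : 0 ≤ L)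
      gcongr
    have h3 : C₀ * M ^ L * r₀ = 1 / 2 := by rw [hr₀]; field_simp
    have h4 := (abs_le.1 (h1.trans (h2.trans h3.le))).2
    nlinarith
  -- All eigenvalues at the single radius r₀ are at least 1/2, so by Parseval the average is bounded
  -- below.
  have hlow : ∀ g : Lp ℂ 2 μ, 1 / 4 * ‖g‖ ^ 2 ≤ ‖ballOp μ r₀ g‖ ^ 2 := by
    intro g
    obtain ⟨m, hm⟩ := exists_spectral_weights (ballOp_isSymmetric μ hG.dist_mul_left) _
      (topologicalClosure_iSup_jointEigenspace_ballOp μ hG.dist_mul_left hG.dist_mul_right) g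
    have h1 := hm (ContinuousLinearMap.id ℂ _) (fun _ => 1) fun l v _ => by simp
    have h2 := hm (ballOp μ r₀) (fun l => (l : ℝ → ℝ) r₀) fun l v hv =>
      mem_jointEigenspace.1 hv r₀
    refine (ENNReal.ofReal_le_ofReal_iff (by positivity)).1 ?_
    rw [h2, ENNReal.ofReal_mul (by norm_num)]
    rw [ContinuousLinearMap.id_apply] at h1
    rw [h1, ← ENNReal.tsum_mul_left]
    refine ENNReal.tsum_le_tsum fun l => ?_
    rw [one_pow, ENNReal.ofReal_one, one_mul]
    gcongr
    exact hspec l l.2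
  set b := μ.real (Metric.ball (1 : G) r₀) with hb
  have hb0 : 0 < b := measure_ball_one_pos μ (hrad M hM1).1
  -- Testing on `ballVec μ s`, whose squared norm is 1/|1_s|, keeps |1_s| ≥ b²/4; letting s → 0
  -- contradicts the dimension condition.
  have hball : ∀ s : ℝ, 0 < s → s < 1 → b ^ 2 / 4 ≤ C₁ * s ^ d₀ := by
    intro s hs hs1
    have h1 := (hlow (ballVec μ s)).trans (pow_le_pow_left₀ (norm_nonneg _)
      (norm_ballOp_ballVec_le μ hG.dist_mul_left hG.dist_mul_right r₀ hs) 2)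
    rw [norm_ballVec_sq μ hs, ← hb] at h1
    have hs0 := measure_ball_one_pos μ hs
    refine le_trans ?_ (hD s hs hs1).2
    rw [inv_pow, ← div_eq_mul_inv, ← one_div (b ^ 2), div_le_div_iff₀ hs0 (by positivity)] at h1
    linarith
  have hlim : Filter.Tendsto (fun s : ℝ => C₁ * s ^ d₀) (nhdsWithin 0 (Set.Ioi 0))
      (nhds (C₁ * 0 ^ d₀)) :=
    ((Real.continuousAt_rpow_const 0 d₀ (Or.inr hd₀.le)).tendsto.mono_left
      nhdsWithin_le_nhds).const_mul C₁
  rw [Real.zero_rpow hd₀.ne', mul_zero] at hlim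
  have := ge_of_tendsto hlim (b := b ^ 2 / 4) (by
    filter_upwards [Ioo_mem_nhdsGT (zero_lt_one' ℝ)] with s hs
    exact hball s hs.1 hs.2)
  have : 0 < b ^ 2 := by positivity
  linarith

end LocallyRandom

/-! ### A scalar lemma on sequences jumping from 0 to 1 -/

section Sequences

/-- The squared increments of the sequence `0, x 0, x 1, …`. -/
def sqIncrement (x : ℕ → ℝ) : ℕ → ℝ
  | 0 => x 0 ^ 2
  | i + 1 => (x (i + 1) - x i) ^ 2

/-- A sequence that stays near `0` and then jumps to near `1` within two steps. -/
theorem sqIncrement_bounds {x : ℕ → ℝ} (hx : ∀ i, |x i| ≤ 1)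
    (hjump : ∀ i, |x i| ≤ (1 / 8) ^ (i + 1) ∨ |1 - x (i + 1)| ≤ (1 / 8) ^ (i + 1))
    (hlim : Filter.Tendsto x Filter.atTop (nhds 1)) :
    ENNReal.ofReal (1 / 8) ≤ ∑' i, ENNReal.ofReal (sqIncrement x i) ∧
      ∑' i, ENNReal.ofReal (sqIncrement x i) ≤ ENNReal.ofReal 16 := by
  have hpow : ∀ i : ℕ, ((1 : ℝ) / 8) ^ (i + 1) ≤ 1 / 8 := fun i => by
    rw [pow_succ]
    have := pow_le_one₀ (by norm_num : (0 : ℝ) ≤ 1 / 8) (by norm_num) (n := i)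
    linarith
  have hex : ∃ i, (1 / 8 : ℝ) ^ (i + 1) < |x i| := by
    obtain ⟨i, hi⟩ := (hlim.eventually (lt_mem_nhds (by norm_num : (1 / 8 : ℝ) < 1))).exists
    exact ⟨i, (hpow i).trans_lt (hi.trans_le (le_abs_self _))⟩
  classical
  -- n is the first index where x is not small. From n + 1 on, x is near 1: being within 1/8 of 1
  -- rules out the small alternative at the next step.
  set n := Nat.find hex with hn
  have hsmall : ∀ i < n, |x i| ≤ (1 / 8) ^ (i + 1) := fun i hi => not_lt.1 (Nat.find_min hex hi)
  have hlarge : ∀ k, |1 - x (n + k + 1)| ≤ (1 / 8) ^ (n + k + 1) := by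
    intro k
    induction k with
    | zero => exact (hjump n).resolve_left (not_le.2 (Nat.find_spec hex))
    | succ k ih =>
      refine (hjump (n + (k + 1))).resolve_left fun h => ?_
      have h1 := abs_le.1 (ih.trans (hpow _))
      have h2 := abs_le.1 (h.trans (hpow _))
      rw [← add_assoc] at h2
      linarith [h1.2, h2.2]
  have hnn : ∀ i, 0 ≤ sqIncrement x i := fun i => by cases i <;> exact sq_nonneg _
  refine ⟨?_, ?_⟩
  · have hsum : 1 / 8 ≤ sqIncrement x n + sqIncrement x (n + 1) := by
      have h1 := (abs_le.1 ((hlarge 0).trans (hpow _))).2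
      rw [add_zero] at h1
      rcases hn0 : n with _ | k
      · rw [hn0] at h1
        simp only [sqIncrement]
        nlinarith [sq_nonneg (x 0 - (x (0 + 1) - x 0))]
      · rw [hn0] at h1
        have h2 := (abs_le.1 ((hsmall k (by omega)).trans (hpow _))).2
        simp only [sqIncrement]
        nlinarith [sq_nonneg ((x (k + 1) - x k) - (x (k + 1 + 1) - x (k + 1)))]
    calc ENNReal.ofReal (1 / 8)
        ≤ ENNReal.ofReal (sqIncrement x n + sqIncrement x (n + 1)) := ENNReal.ofReal_le_ofReal hsum
      _ = ∑ i ∈ {n, n + 1}, ENNReal.ofReal (sqIncrement x i) := by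
          rw [Finset.sum_pair (by omega), ENNReal.ofReal_add (hnn _) (hnn _)]
      _ ≤ _ := ENNReal.sum_le_tsum _
  · have hterm : ∀ i, sqIncrement x i ≤
        (if i = n then 4 else 0) + (if i = n + 1 then 4 else 0) + 4 * (1 / 4) ^ i := by
      intro i
      have hp : (0 : ℝ) ≤ (1 / 4) ^ i := by positivity
      have h4 : sqIncrement x i ≤ 4 := by
        cases i with
        | zero => simp only [sqIncrement]; nlinarith [abs_le.1 (hx 0)]
        | succ i =>
          simp only [sqIncrement]
          nlinarith [abs_le.1 (hx i), abs_le.1 (hx (i + 1))]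
      by_cases h1 : i = n
      · rw [if_pos h1]; split_ifs <;> linarith
      by_cases h2 : i = n + 1
      · rw [if_neg h1, if_pos h2]; linarith
      rw [if_neg h1, if_neg h2, add_zero, zero_add]
      have hq : ((1 : ℝ) / 4) ^ i = ((1 / 2) ^ i) ^ 2 := by
        rw [← pow_mul, mul_comm, pow_mul]; norm_num
      have hq3 : ((1 : ℝ) / 8) ^ i = ((1 / 2) ^ i) ^ 3 := by
        rw [← pow_mul, mul_comm, pow_mul]; norm_num
      have hq0 : (0 : ℝ) < (1 / 2) ^ i := by positivity
      have hq1 : ((1 : ℝ) / 2) ^ i ≤ 1 := pow_le_one₀ (by norm_num) (by norm_num)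
      have key : ∀ d : ℝ, |d| ≤ 2 * (1 / 2) ^ i → d ^ 2 ≤ 4 * (1 / 4) ^ i := fun d hd => by
        rw [← sq_abs, hq]
        nlinarith [abs_nonneg d]
      have hcube : ((1 : ℝ) / 8) ^ i ≤ (1 / 2) ^ i := by
        rw [hq3]
        exact pow_le_of_le_one hq0.le hq1 (by norm_num)
      cases i with
      | zero =>
        refine key _ ((hsmall 0 (by omega)).trans ?_)
        norm_num
      | succ i =>
        refine key _ ?_
        have hs : ((1 : ℝ) / 8) ^ (i + 1 + 1) ≤ (1 / 8) ^ (i + 1) :=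
          pow_le_pow_of_le_one (by norm_num) (by norm_num) (by omega)
        rcases lt_or_ge (i + 1) n with h | h
        · have a1 := abs_le.1 (hsmall i (by omega))
          have a2 := abs_le.1 ((hsmall (i + 1) h).trans hs)
          rw [abs_le]; constructor <;> linarith [a1.1, a1.2, a2.1, a2.2]
        · obtain ⟨k, rfl⟩ : ∃ k, i = n + k + 1 := ⟨i - n - 1, by omega⟩
          have a1 := abs_le.1 (hlarge k)
          have a2 := abs_le.1 (hlarge (k + 1))
          rw [← add_assoc] at a2
          have h8 : ((1 : ℝ) / 8) ^ (n + k + 1) = 8 * (1 / 8) ^ (n + k + 1 + 1) := by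
            rw [pow_succ _ (n + k + 1)]; ring
          have hq4 : ((1 : ℝ) / 2) ^ (n + k + 1 + 1) ≤ 1 / 4 := by
            calc ((1 : ℝ) / 2) ^ (n + k + 1 + 1) ≤ (1 / 2) ^ 2 :=
                  pow_le_pow_of_le_one (by norm_num) (by norm_num) (by omega)
              _ = 1 / 4 := by norm_num
          have h9 : 9 * ((1 : ℝ) / 8) ^ (n + k + 1 + 1) ≤ 2 * (1 / 2) ^ (n + k + 1 + 1) := by
            rw [hq3]
            nlinarith [mul_nonneg hq0.le (sub_nonneg.2 hq4),
              sq_nonneg (((1 : ℝ) / 2) ^ (n + k + 1 + 1))]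
          rw [abs_le]; constructor <;> linarith [a1.1, a1.2, a2.1, a2.2]
    have hs1 : HasSum (fun i => if i = n then (4 : ℝ) else 0) 4 := hasSum_ite_eq n 4
    have hs2 : HasSum (fun i => if i = n + 1 then (4 : ℝ) else 0) 4 := hasSum_ite_eq (n + 1) 4
    have hs3 : HasSum (fun i : ℕ => 4 * ((1 : ℝ) / 4) ^ i) (4 * (1 - 1 / 4)⁻¹) :=
      (hasSum_geometric_of_lt_one (by norm_num) (by norm_num)).mul_left 4
    have hs := (hs1.add hs2).add hs3
    calc ∑' i, ENNReal.ofReal (sqIncrement x i)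
        ≤ ∑' i, ENNReal.ofReal ((if i = n then 4 else 0) + (if i = n + 1 then 4 else 0)
            + 4 * (1 / 4) ^ i) := ENNReal.tsum_le_tsum fun i => ENNReal.ofReal_le_ofReal (hterm i)
      _ = ENNReal.ofReal (4 + 4 + 4 * (1 - 1 / 4)⁻¹) := by
          rw [← ENNReal.ofReal_tsum_of_nonneg (fun i => by positivity) hs.summable, hs.tsum_eq]
      _ ≤ ENNReal.ofReal 16 := ENNReal.ofReal_le_ofReal (by norm_num)

end Sequences

/-! ### Decay of the scales -/

section Scales

theorem scale_pos {η₀ a : ℝ} (hη : 0 < η₀) (i : ℕ) : 0 < scale η₀ a i :=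
  Real.rpow_pos_of_pos hη _

theorem scale_succ {η₀ a : ℝ} (hη : 0 < η₀) (i : ℕ) :
    scale η₀ a (i + 1) = scale η₀ a i ^ a := by
  rw [scale, scale, ← Real.rpow_mul hη.le, pow_succ]

theorem add_one_le_pow_of_four_le {a : ℝ} (ha : 4 ≤ a) (i : ℕ) : (i : ℝ) + 1 ≤ a ^ i := by
  have := one_add_mul_le_pow (by linarith : (-2 : ℝ) ≤ a - 1) i
  rw [add_sub_cancel] at this
  nlinarith [(Nat.cast_nonneg i : (0 : ℝ) ≤ i)]

theorem scale_le_pow {η₀ a : ℝ} (hη : 0 < η₀) (hη1 : η₀ ≤ 1) (ha : 4 ≤ a) (i : ℕ) :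
    scale η₀ a i ≤ η₀ ^ (i + 1) := by
  rw [scale, ← Real.rpow_natCast η₀]
  refine Real.rpow_le_rpow_of_exponent_ge hη hη1 ?_
  exact_mod_cast add_one_le_pow_of_four_le ha i

theorem tendsto_scale {η₀ a : ℝ} (hη : 0 < η₀) (hη1 : η₀ < 1) (ha : 4 ≤ a) :
    Filter.Tendsto (scale η₀ a) Filter.atTop (nhds 0) :=
  squeeze_zero (fun i => (scale_pos hη i).le) (scale_le_pow hη hη1.le ha)
    ((tendsto_pow_atTop_nhds_zero_of_lt_one hη.le hη1).comp (Filter.tendsto_add_atTop_nat 1))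

/-- Replacing d₀ by its lower bound 1/L leaves an estimate in η₀ and L alone, so the threshold for
η₀ need not depend on d₀. -/
theorem scale_rpow_le_pow {η₀ a d₀ L : ℝ} (hη : 0 < η₀) (hη1 : η₀ ≤ 1) (ha : 4 ≤ a) (hL : 0 < L)
    (hLd : 1 ≤ L * d₀) (i : ℕ) : scale η₀ a i ^ d₀ ≤ (η₀ ^ L⁻¹) ^ (i + 1) := by
  rw [scale, ← Real.rpow_mul hη.le, ← Real.rpow_natCast (η₀ ^ L⁻¹), ← Real.rpow_mul hη.le]
  refine Real.rpow_le_rpow_of_exponent_ge hη hη1 ?_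
  have h1 := add_one_le_pow_of_four_le ha i
  have h2 : L⁻¹ ≤ d₀ := (inv_le_iff_one_le_mul₀' hL).2 hLd
  push_cast
  rw [mul_comm]
  have : 0 ≤ L⁻¹ := inv_nonneg.2 hL.le
  gcongr

end Scales

/-! ### The spectral dichotomy and the Littlewood–Paley inequality -/

section LittlewoodPaleyInequality

variable {G : Type u} [Group G] [MetricSpace G] [IsTopologicalGroup G] [CompactSpace G]
  [MeasurableSpace G] [BorelSpace G] (μ : Measure G) [μ.IsHaarMeasure] [IsProbabilityMeasure μ]
  {L C₀ C₁ d₀ a η₀ : ℝ}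

theorem IsLocallyRandom.sqIncrement_bounds (hG : IsLocallyRandom G L C₀)
    (hD : DimensionCondition μ C₁ d₀) (hC₀ : 1 ≤ C₀) (hC₁ : 1 ≤ C₁) (hL : 1 ≤ L) (hd₀ : 0 < d₀)
    (ha : 4 * L * d₀ ≤ a) (hη : 0 < η₀) (hε : η₀ < (64 * (C₀ * C₁))⁻¹ ^ L) {l : ℝ → ℝ}
    (hl : l ∈ irreducibleSpectrum (regRep μ) (ballOp μ)) :
    ENNReal.ofReal (1 / 8) ≤ ∑' i, ENNReal.ofReal (sqIncrement (fun i => l (scale η₀ a i)) i) ∧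
      ∑' i, ENNReal.ofReal (sqIncrement (fun i => l (scale η₀ a i)) i) ≤ ENNReal.ofReal 16 := by
  have hLd := hG.one_le_mul μ hD hC₀ hC₁ hL hd₀
  have ha4 : 4 ≤ a := by linarith
  have hCC : 1 ≤ C₀ * C₁ := one_le_mul_of_one_le_of_one_le hC₀ hC₁
  have hη1 : η₀ < 1 := hε.trans_le (Real.rpow_le_one (by positivity)
    (inv_le_one_of_one_le₀ (by linarith)) (by linarith))
  have hroot : η₀ ^ L⁻¹ ≤ (64 * (C₀ * C₁))⁻¹ := by
    have := Real.rpow_le_rpow hη.le hε.le (inv_nonneg.2 (by linarith : 0 ≤ L))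
    rwa [← Real.rpow_mul (by positivity), mul_inv_cancel₀ (by linarith), Real.rpow_one] at this
  -- The base 64 = 8² is chosen because the Hilbert–Schmidt bound controls the square of the
  -- eigenvalue.
  have hsmall : ∀ i, C₀ * C₁ * scale η₀ a i ^ d₀ ≤ (1 / 64) ^ (i + 1) := by
    intro i
    have h1 := (scale_rpow_le_pow hη hη1.le ha4 (by linarith) hLd i).trans
      (pow_le_pow_left₀ (by positivity) hroot (i + 1))
    have h2 : C₀ * C₁ ≤ (C₀ * C₁) ^ (i + 1) := le_self_pow₀ hCC (by omega)
    calc C₀ * C₁ * scale η₀ a i ^ d₀ ≤ (C₀ * C₁) ^ (i + 1) * (64 * (C₀ * C₁))⁻¹ ^ (i + 1) := by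
          gcongr
          exact Real.rpow_nonneg (scale_pos hη i).le _
      _ = (1 / 64) ^ (i + 1) := by
          rw [← mul_pow]
          congr 1
          field_simp
  obtain ⟨D, hD1, hlD⟩ := hG.exists_dim μ (by linarith) hl
  refine LittlewoodPaley.sqIncrement_bounds
    (fun i => abs_le_one_of_mem_irreducibleSpectrum μ hl _) (fun i => ?_) ?_
  · have hs0 := scale_pos (a := a) hη i
    have hs1 : scale η₀ a i < 1 :=
      (scale_le_pow hη hη1.le ha4 i).trans_lt (pow_lt_one₀ hη.le hη1 (by omega))
    set q := scale η₀ a i ^ d₀ with hq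
    have hq0 : 0 < q := Real.rpow_pos_of_pos hs0 _
    have hq1 : q ≤ 1 := Real.rpow_le_one hs0.le hs1.le hd₀.le
    -- If D q² ≥ 1, then l² ≤ C₁/(D q) ≤ C₁ q. If not, D q⁴ ≤ q² ≤ q and |1 - l| ≤ C₀ (D q⁴)^L ≤ C₀
    -- q at the next scale.
    rcases le_or_gt 1 (D * q ^ 2) with h | h
    · left
      have h1 := (hlD _ hs0).2.trans (hD.inv_measure_ball_le μ hC₁ hs0 hs1)
      rw [Real.rpow_neg hs0.le, ← hq] at h1
      refine abs_le_of_sq_le_sq ?_ (by positivity)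
      calc l (scale η₀ a i) ^ 2 ≤ l (scale η₀ a i) ^ 2 * (D * q ^ 2) :=
            le_mul_of_one_le_right (sq_nonneg _) h
        _ = (D * l (scale η₀ a i) ^ 2) * q ^ 2 := by ring
        _ ≤ (C₁ * q⁻¹) * q ^ 2 := by gcongr
        _ = C₁ * q := by field_simp
        _ ≤ C₀ * C₁ * q := by
            have : 0 ≤ C₁ * q := by positivity
            nlinarith
        _ ≤ (1 / 64) ^ (i + 1) := hsmall i
        _ = ((1 / 8) ^ (i + 1)) ^ 2 := by rw [← pow_mul, mul_comm, pow_mul]; norm_num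
    · right
      refine (hlD _ (scale_pos hη (i + 1))).1.trans ?_
      have h1 : scale η₀ a (i + 1) ≤ (q ^ 4) ^ L := by
        rw [scale_succ hη, hq, ← Real.rpow_natCast, ← Real.rpow_mul hs0.le,
          ← Real.rpow_mul hs0.le]
        refine Real.rpow_le_rpow_of_exponent_ge hs0 hs1.le ?_
        push_cast
        linarith
      have h2 : D * q ^ 4 ≤ q := by nlinarith [mul_pos hq0 hq0]
      calc C₀ * D ^ L * scale η₀ a (i + 1) ≤ C₀ * D ^ L * (q ^ 4) ^ L := by gcongr
        _ = C₀ * (D * q ^ 4) ^ L := by rw [Real.mul_rpow (by linarith) (by positivity), mul_assoc]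
        _ ≤ C₀ * q ^ L := by gcongr
        _ ≤ C₀ * q := by
            gcongr
            simpa using Real.rpow_le_rpow_of_exponent_ge hq0 hq1 hL
        _ ≤ C₀ * C₁ * q := by
            have : 0 ≤ C₀ * q := by positivity
            nlinarith
        _ ≤ (1 / 64) ^ (i + 1) := hsmall i
        _ ≤ (1 / 8) ^ (i + 1) := pow_le_pow_left₀ (by norm_num) (by norm_num) _
  · rw [tendsto_iff_norm_sub_tendsto_zero]
    refine squeeze_zero (fun _ => norm_nonneg _) (fun i => ?_)
      (g := fun i => C₀ * D ^ L * scale η₀ a i)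
      (by simpa using (tendsto_scale hη hη1 ha4).const_mul (C₀ * D ^ L))
    rw [Real.norm_eq_abs, abs_sub_comm]
    exact (hlD _ (scale_pos hη i)).1

variable (η₀ a) in
/-- The operators `Delta μ η₀ a i` on `L²(G)`. -/
def deltaOp : ℕ → Lp ℂ 2 μ →L[ℂ] Lp ℂ 2 μ
  | 0 => ballOp μ (scale η₀ a 0)
  | i + 1 => ballOp μ (scale η₀ a (i + 1)) - ballOp μ (scale η₀ a i)

theorem conv_ballAvg_sub {g : G → ℂ} (hg : MemLp g 2 μ) (r s : ℝ) :
    conv μ (ballAvg μ r - ballAvg μ s) g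
      = conv μ (ballAvg μ r) g - conv μ (ballAvg μ s) g := by
  have hint : ∀ r x, Integrable (fun y => ballAvg μ r y * g (y⁻¹ * x)) μ := fun r x =>
    (memLp_ballAvg μ r 2).integrable_mul (memLp_comp_div_left μ hg x)
  ext x
  simp only [conv, Pi.sub_apply, sub_mul]
  exact integral_sub (hint r x) (hint s x)

theorem conv_ballAvg_ae_eq (hl : ∀ x y z : G, dist (z * x) (z * y) = dist x y)
    (hr : ∀ x y z : G, dist (x * z) (y * z) = dist x y) {g : G → ℂ} (hg : MemLp g 2 μ) (r : ℝ) :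
    conv μ (ballAvg μ r) g =ᵐ[μ] ballOp μ r (hg.toLp g) := by
  rw [ballOp_eq_toLp μ hl hr]
  filter_upwards [BoundedContinuousFunction.coeFn_toLp (p := 2) (𝕜 := ℂ) μ
    (ballConv μ r (hg.toLp g))] with x hx
  rw [hx, conv_ballAvg_eq_inner μ hl hr r hg, ballConv_apply]

theorem Delta_ae_eq (hl : ∀ x y z : G, dist (z * x) (z * y) = dist x y)
    (hr : ∀ x y z : G, dist (x * z) (y * z) = dist x y) {g : G → ℂ} (hg : MemLp g 2 μ) (i : ℕ) :
    Delta μ η₀ a i g =ᵐ[μ] deltaOp μ a η₀ i (hg.toLp g) := by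
  cases i with
  | zero => exact conv_ballAvg_ae_eq μ hl hr hg _
  | succ i =>
    rw [Delta, conv_ballAvg_sub μ hg]
    exact ((conv_ballAvg_ae_eq μ hl hr hg _).sub (conv_ballAvg_ae_eq μ hl hr hg _)).trans
      (Lp.coeFn_sub _ _).symm

theorem ofReal_norm_sq_eq_eLpNorm (f : Lp ℂ 2 μ) :
    ENNReal.ofReal (‖f‖ ^ 2) = eLpNorm f 2 μ ^ 2 := by
  rw [ENNReal.ofReal_pow (norm_nonneg _), ofReal_norm, Lp.enorm_def]

/-- On each joint eigenspace `deltaOp` acts by an increment of the eigenvalue sequence, so Parseval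
and an exchange of sums reduce the claim to the scalar bounds. -/
theorem IsLocallyRandom.littlewoodPaley (hG : IsLocallyRandom G L C₀)
    (hD : DimensionCondition μ C₁ d₀) (hC₀ : 1 ≤ C₀) (hC₁ : 1 ≤ C₁) (hL : 1 ≤ L) (hd₀ : 0 < d₀)
    (ha : 4 * L * d₀ ≤ a) (hη : 0 < η₀) (hε : η₀ < (64 * (C₀ * C₁))⁻¹ ^ L) (g : Lp ℂ 2 μ) :
    ENNReal.ofReal (1 / 8) * ENNReal.ofReal (‖g‖ ^ 2)
        ≤ ∑' i, ENNReal.ofReal (‖deltaOp μ a η₀ i g‖ ^ 2) ∧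
      ∑' i, ENNReal.ofReal (‖deltaOp μ a η₀ i g‖ ^ 2)
        ≤ ENNReal.ofReal 16 * ENNReal.ofReal (‖g‖ ^ 2) := by
  obtain ⟨m, hm⟩ := exists_spectral_weights (ballOp_isSymmetric μ hG.dist_mul_left) _
    (topologicalClosure_iSup_jointEigenspace_ballOp μ hG.dist_mul_left hG.dist_mul_right) g
  have h1 : ENNReal.ofReal (‖g‖ ^ 2) = ∑' l, m l := by
    simpa using hm (ContinuousLinearMap.id ℂ _) (fun _ => 1) fun l v _ => by simp
  have h2 : ∀ i, ENNReal.ofReal (‖deltaOp μ a η₀ i g‖ ^ 2) = ∑' l : irreducibleSpectrum (regRep μ)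
      (ballOp μ), ENNReal.ofReal (sqIncrement (fun i => (l : ℝ → ℝ) (scale η₀ a i)) i) * m l := by
    intro i
    cases i with
    | zero =>
      exact hm _ (fun l => (l : ℝ → ℝ) (scale η₀ a 0)) fun l v hv => mem_jointEigenspace.1 hv _
    | succ i =>
      refine hm _ (fun l => (l : ℝ → ℝ) (scale η₀ a (i + 1)) - (l : ℝ → ℝ) (scale η₀ a i))
        fun l v hv => ?_
      rw [deltaOp, sub_apply, mem_jointEigenspace.1 hv, mem_jointEigenspace.1 hv,
        Complex.ofReal_sub, sub_smul]
  have h3 : ∑' i, ENNReal.ofReal (‖deltaOp μ a η₀ i g‖ ^ 2)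
      = ∑' l : irreducibleSpectrum (regRep μ) (ballOp μ),
        (∑' i, ENNReal.ofReal (sqIncrement (fun i => (l : ℝ → ℝ) (scale η₀ a i)) i)) * m l := by
    simp only [h2]
    rw [ENNReal.tsum_comm]
    simp only [ENNReal.tsum_mul_right]
  have hb := fun l : irreducibleSpectrum (regRep μ) (ballOp μ) =>
    hG.sqIncrement_bounds μ hD hC₀ hC₁ hL hd₀ ha hη hε l.2
  rw [h3, h1, ← ENNReal.tsum_mul_left, ← ENNReal.tsum_mul_left]
  exact ⟨ENNReal.tsum_le_tsum fun l => mul_le_mul_left (hb l).1 _,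
    ENNReal.tsum_le_tsum fun l => mul_le_mul_left (hb l).2 _⟩

end LittlewoodPaleyInequality

end LittlewoodPaley
end

theorem mainTheorem8 :
    ∃ c C : ℝ≥0, 0 < c ∧
      ∀ C₀ C₁ L : ℝ, 1 ≤ C₀ → 1 ≤ C₁ → 1 ≤ L →
        ∃ ε : ℝ, 0 < ε ∧
          ∀ (G : Type u) [Group G] [MetricSpace G] [IsTopologicalGroup G] [CompactSpace G]
            [MeasurableSpace G] [BorelSpace G]
            (μ : Measure G) [μ.IsHaarMeasure] [IsProbabilityMeasure μ] (d₀ a η₀ : ℝ),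
            IsLocallyRandom G L C₀ → 0 < d₀ → DimensionCondition μ C₁ d₀ →
            4 * L * d₀ ≤ a → 0 < η₀ → η₀ < ε →
            ∀ g : G → ℂ, MemLp g 2 μ →
              (∀ i : ℕ, MemLp (Delta μ η₀ a i g) 2 μ) ∧
              (c : ℝ≥0∞) * eLpNorm g 2 μ ^ 2 ≤ ∑' i : ℕ, eLpNorm (Delta μ η₀ a i g) 2 μ ^ 2 ∧
              ∑' i : ℕ, eLpNorm (Delta μ η₀ a i g) 2 μ ^ 2 ≤ (C : ℝ≥0∞) * eLpNorm g 2 μ ^ 2 := by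
  refine ⟨Real.toNNReal (1 / 8), Real.toNNReal 16, Real.toNNReal_pos.2 (by norm_num),
    fun C₀ C₁ L hC₀ hC₁ hL => ⟨(64 * (C₀ * C₁))⁻¹ ^ L, by positivity, ?_⟩⟩
  intro G _ _ _ _ _ _ μ _ _ d₀ a η₀ hG hd₀ hD ha hη hε g hg
  have hΔ := fun i => Delta_ae_eq μ (η₀ := η₀) (a := a) hG.dist_mul_left hG.dist_mul_right hg i
  refine ⟨fun i => (memLp_congr_ae (hΔ i)).2 (Lp.memLp _), ?_⟩
  have h := hG.littlewoodPaley μ hD hC₀ hC₁ hL hd₀ ha hη hε (hg.toLp g)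
  simp only [ofReal_norm_sq_eq_eLpNorm, eLpNorm_congr_ae hg.coeFn_toLp] at h
  simp only [eLpNorm_congr_ae (hΔ _)]
  exact h
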